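/- \textbf{Setting.} Let $K$ be an algebraically closed field, $Q$ a finite quiver with vertex set $Q_0$, $I$ an admissible ideal of the path algebra $KQ$ (that is, $R^m\subseteq I\subseteq R^2$ for some $m\ge 2$, where $R$ is the ideal generated by the arrows), $A=KQ/I$, and $\leqslant$ a partial order on $Q_0$. A path $j\to\cdots\to i\to\cdots\to k$ is written as the product $(i\to\cdots\to k)\cdot(j\to\cdots\to i)$, and $e_i$ is the trivial path at $i$. Modules are left modules. For a finite-dimensional module $M$ put $[M:S(k)]=\dim_K e_kM$, where $S(k)$ is the simple module at $k$; $P(j)=Ae_j$ is the projective and $I(j)=\operatorname{Hom}_K(e_jA,K)$ the injective indecomposable module at $j$. The standard module $\Delta(i)$ is the largest factor module of $P(i)$, and the costandard module $\nabla(i)$ the largest submodule of $I(i)$, having $[\,\cdot\,:S(j)]=0$ for all $j\not\leqslant i$. A $\Delta$-good filtration of $M$ is a finite filtration of $M$ all of whose subquotients are isomorphic to standard modules, and $(M:\Delta(i))$ is the number of subquotients isomorphic to $\Delta(i)$ in such a filtration. $(A,\leqslant)$ is \emph{quasi-hereditary} if for all $i,j\in Q_0$: $[\Delta(i):S(i)]=1$,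 $P(i)$ has a $\Delta$-good filtration, $(P(i):\Delta(j))=0$ unless $j\geqslant i$, and $(P(i):\Delta(i))=1$. It is \emph{1-quasi-hereditary} if moreover (1) $(Q_0,\leqslant)$ has a smallest element $1$ and a largest element $n$; and for all $i,j\in Q_0$: (2) $[\Delta(i):S(j)]=(P(j):\Delta(i))=1$ if $j\leqslant i$; (3) $\operatorname{soc}P(j)\cong\operatorname{top}I(j)\cong S(1)$; (4) there are an injective homomorphism $\Delta(i)\hookrightarrow\Delta(n)$ and a surjective homomorphism $\nabla(n)\twoheadrightarrow\nabla(i)$. A path in $Q$ is increasing (decreasing) if each of its arrows goes to a strictly larger (strictly smaller) vertex; trivial paths are both. \textbf{Theorem.} Let $A=KQ/I$ with $\leqslant$ be 1-quasi-hereditary. For all $j,i,k\in Q_0$ with $i\geqslant j$ and $i\geqslant k$ there is a path from $j$ to $k$ in $Q$ which is the concatenation of an increasing path from $j$ to $i$ and a decreasing path from $i$ to $k$. Fix one such path $p(j,i,k)$ for every such triple. Then: \begin{itemize} \item for all $j,k\in Q_0$ the images in $A$ of the paths $p(j,i,k)$ with $i\geqslant j,k$ form a $K$-basis of $P(j)_k=e_kP(j)$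 (the family indexed by $i$ being a basis, so in particular its members are distinct); \item for every $j\in Q_0$ the images of the paths $p(j,i,k)$ with $i\geqslant j$ and $k\leqslant i$ form a $K$-basis of $P(j)$; \item the images of the paths $p(j,i,k)$ with $j,i,k\in Q_0$ and $i\geqslant j,k$ form a $K$-basis of $A$; \item there are scalars $c_{q,i}\in K$, for every path $q$ of $Q$, say from $j$ to $k$, and every $i\geqslant j,k$, such that $I$ is generated, as a two-sided ideal of $KQ$, by the elements \[ q-\sum_{i\geqslant j,k}c_{q,i}\,p(j,i,k)\in KQ ,\qquad j,k\in Q_0,\ q \text{ a path from } j \text{ to } k . \] \end{itemize} -/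

import Mathlib

noncomputable section

/-! ## The path algebra of a quiver -/

section PathAlgebra

variable (K : Type*) [Field K] (V : Type*) [Quiver V]

/-- A path of the quiver together with its source and its target. -/
abbrev QPath : Type _ := Σ j k : V, Quiver.Path j k

/-- The path algebra `KQ`: the vector space with basis the paths of `Q`.
Paths are multiplied as functions are composed: `p * q` is "first `q`, then `p`". -/
def PathAlgebra : Type _ := QPath V →₀ K

namespace PathAlgebra

instance : AddCommGroup (PathAlgebra K V) := inferInstanceAs (AddCommGroup (QPath V →₀ K))

instance : Module K (PathAlgebra K V) := inferInstanceAs (Module K (QPath V →₀ K))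

variable {V}

/-- The basis element of `KQ` given by a path. -/
def ofPath {j k : V} (p : Quiver.Path j k) : PathAlgebra K V :=
  Finsupp.single (⟨j, k, p⟩ : QPath V) (1 : K)

open scoped Classical in
/-- The product of two paths: their concatenation "first `q`, then `p`" if `q` ends where `p`
starts, and zero otherwise. -/
def mulPath (p q : QPath V) : PathAlgebra K V :=
  if h : q.2.1 = p.1 then ofPath K (q.2.2.comp (p.2.2.cast h.symm rfl)) else 0

/-- The bilinear extension of the product of paths. -/
def mulHom : PathAlgebra K V →ₗ[K] PathAlgebra K V →ₗ[K] PathAlgebra K V :=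
  Finsupp.linearCombination K
    (fun p : QPath V => (Finsupp.linearCombination K (fun q : QPath V => mulPath K p q) :
      PathAlgebra K V →ₗ[K] PathAlgebra K V))

instance : Mul (PathAlgebra K V) := ⟨fun x y => mulHom K x y⟩

instance [Fintype V] : One (PathAlgebra K V) :=
  ⟨∑ i : V, ofPath K (Quiver.Path.nil : Quiver.Path i i)⟩

theorem mul_def (x y : PathAlgebra K V) : x * y = mulHom K x y := rfl

theorem one_def [Fintype V] :
    (1 : PathAlgebra K V) = ∑ i : V, ofPath K (Quiver.Path.nil : Quiver.Path i i) := rfl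

theorem mulHom_ofPath {a b c d : V} (p : Quiver.Path a b) (q : Quiver.Path c d) :
    mulHom K (ofPath K p) (ofPath K q) = mulPath K ⟨a, b, p⟩ ⟨c, d, q⟩ := by
  have h1 : mulHom K (ofPath K p) =
      (Finsupp.linearCombination K (fun q : QPath V => mulPath K ⟨a, b, p⟩ q) :
        PathAlgebra K V →ₗ[K] PathAlgebra K V) := by
    refine (Finsupp.linearCombination_single K _ _).trans ?_
    exact one_smul _ _
  rw [h1]
  refine (Finsupp.linearCombination_single K _ _).trans ?_
  exact one_smul _ _

theorem ofPath_mul_ofPath {a b c : V} (p : Quiver.Path b c) (q : Quiver.Path a b) :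
    ofPath K p * ofPath K q = ofPath K (q.comp p) := by
  rw [mul_def, mulHom_ofPath]
  simp [mulPath]

theorem ofPath_mul_ofPath_of_ne {a b c d : V} (p : Quiver.Path c d) (q : Quiver.Path a b)
    (h : b ≠ c) : ofPath K p * ofPath K q = 0 := by
  rw [mul_def, mulHom_ofPath]
  simp [mulPath, h]

/-- Linear maps on `KQ` that agree on all paths are equal. -/
theorem hom_ext {M : Type*} [AddCommGroup M] [Module K M] {f g : PathAlgebra K V →ₗ[K] M}
    (h : ∀ (j k : V) (p : Quiver.Path j k), f (ofPath K p) = g (ofPath K p)) : f = g :=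
  Finsupp.lhom_ext' fun ⟨j, k, p⟩ => LinearMap.ext_ring (h j k p)

theorem ofPath_mul_assoc {a b c d e f : V} (p : Quiver.Path a b) (q : Quiver.Path c d)
    (r : Quiver.Path e f) :
    ofPath K p * ofPath K q * ofPath K r = ofPath K p * (ofPath K q * ofPath K r) := by
  have hz : ∀ x : PathAlgebra K V, 0 * x = 0 := fun x => by simp [mul_def]
  have zh : ∀ x : PathAlgebra K V, x * 0 = 0 := fun x => by simp [mul_def]
  by_cases h1 : d = a
  · subst h1
    by_cases h2 : f = c
    · subst h2
      simp only [ofPath_mul_ofPath, Quiver.Path.comp_assoc]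
    · simp only [ofPath_mul_ofPath, ofPath_mul_ofPath_of_ne K _ _ h2, zh]
  · rw [ofPath_mul_ofPath_of_ne K _ _ h1, hz]
    by_cases h2 : f = c
    · subst h2
      rw [ofPath_mul_ofPath, ofPath_mul_ofPath_of_ne K _ _ h1]
    · rw [ofPath_mul_ofPath_of_ne K _ _ h2, zh]

theorem mul_assoc_aux (x y z : PathAlgebra K V) : x * y * z = x * (y * z) := by
  have e1 : ∀ (a b : V) (p : Quiver.Path a b) (c d : V) (q : Quiver.Path c d),
      mulHom K (mulHom K (ofPath K p) (ofPath K q)) =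
        (mulHom K (ofPath K p)) ∘ₗ (mulHom K (ofPath K q)) := fun a b p c d q =>
    hom_ext K fun e f r => ofPath_mul_assoc K p q r
  have e2 : ∀ (a b : V) (p : Quiver.Path a b) (z : PathAlgebra K V),
      (mulHom K).flip z ∘ₗ mulHom K (ofPath K p) =
        mulHom K (ofPath K p) ∘ₗ (mulHom K).flip z := fun a b p z =>
    hom_ext K fun c d q => LinearMap.congr_fun (e1 a b p c d q) z
  have e3 : (mulHom K).flip z ∘ₗ (mulHom K).flip y = (mulHom K).flip (mulHom K y z) :=
    hom_ext K fun a b p => LinearMap.congr_fun (e2 a b p z) y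
  exact LinearMap.congr_fun e3 x

theorem one_mul_aux [Fintype V] (x : PathAlgebra K V) : 1 * x = x := by
  have h : mulHom K (1 : PathAlgebra K V) = LinearMap.id := by
    refine hom_ext K fun j k p => ?_
    rw [one_def, map_sum, LinearMap.sum_apply, Finset.sum_eq_single k]
    · exact ofPath_mul_ofPath K _ p
    · exact fun b _ hb => ofPath_mul_ofPath_of_ne K _ p hb.symm
    · exact fun hk => absurd (Finset.mem_univ k) hk
  exact LinearMap.congr_fun h x

theorem mul_one_aux [Fintype V] (x : PathAlgebra K V) : x * 1 = x := by
  have h : (mulHom K).flip (1 : PathAlgebra K V) = LinearMap.id := by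
    refine hom_ext K fun j k p => ?_
    rw [one_def, map_sum, LinearMap.sum_apply, Finset.sum_eq_single j]
    · exact (ofPath_mul_ofPath K p _).trans (by simp)
    · exact fun b _ hb => ofPath_mul_ofPath_of_ne K p _ hb
    · exact fun hk => absurd (Finset.mem_univ j) hk
  exact LinearMap.congr_fun h x

instance [Fintype V] : Ring (PathAlgebra K V) where
  __ := (inferInstance : AddCommGroup (PathAlgebra K V))
  mul_assoc := mul_assoc_aux K
  one_mul := one_mul_aux K
  mul_one := mul_one_aux K
  left_distrib x y z := map_add (mulHom K x) y z
  right_distrib x y z := LinearMap.map_add₂ (mulHom K) x y z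
  zero_mul x := LinearMap.map_zero₂ (mulHom K) x
  mul_zero x := map_zero (mulHom K x)

instance [Fintype V] : Algebra K (PathAlgebra K V) :=
  Algebra.ofModule (fun r x y => LinearMap.map_smul₂ (mulHom K) r x y)
    (fun r x y => map_smul (mulHom K x) r y)

/-- `R ^ m` for the arrow ideal `R` of `KQ`: the span of the paths of length at least `m`. -/
def arrowIdealPow (m : ℕ) : Submodule K (PathAlgebra K V) :=
  Submodule.span K {x | ∃ (j k : V) (p : Quiver.Path j k), m ≤ p.length ∧ x = ofPath K p}

variable {K}

/-- An ideal `I` of `KQ` is admissible if `R ^ m ⊆ I ⊆ R ^ 2` for some `m ≥ 2`. -/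
def IsAdmissible [Fintype V] (I : TwoSidedIdeal (PathAlgebra K V)) : Prop :=
  (∃ m : ℕ, 2 ≤ m ∧ ∀ x ∈ arrowIdealPow K m, x ∈ I) ∧ ∀ x ∈ I, x ∈ arrowIdealPow K (V := V) 2

end PathAlgebra

end PathAlgebra

/-! ## Modules over an algebra with idempotents indexed by the vertices

Below `A` is a `K`-algebra, `e : V → A` is the family of idempotents given by the vertices,
and modules are left modules. -/

section Modules

/-- The `K`-dual `Hom_K(A, K)` of the right module `A`, a left module by `(a • φ) x = φ (x * a)`. -/
def DualRegular (K : Type*) [Field K] (A : Type*) [Ring A] [Algebra K A] : Type _ := A →ₗ[K] K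

namespace DualRegular

variable (K : Type*) [Field K] (A : Type*) [Ring A] [Algebra K A]

instance : AddCommGroup (DualRegular K A) := inferInstanceAs (AddCommGroup (A →ₗ[K] K))

instance : Module K (DualRegular K A) := inferInstanceAs (Module K (A →ₗ[K] K))

instance : FunLike (DualRegular K A) A K := inferInstanceAs (FunLike (A →ₗ[K] K) A K)

instance : Module A (DualRegular K A) where
  smul a φ := LinearMap.comp (σ₁₂ := RingHom.id K) (M₃ := K) φ (LinearMap.mulRight K a)
  one_smul φ := LinearMap.ext fun x => congrArg (φ : A → K) (mul_one x)
  mul_smul a b φ := LinearMap.ext fun x => congrArg (φ : A → K) (mul_assoc x a b).symm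
  smul_zero _ := rfl
  smul_add _ _ _ := rfl
  add_smul a b φ := LinearMap.ext fun x =>
    (congrArg (φ : A → K) (mul_add x a b)).trans (LinearMap.map_add (φ : A →ₗ[K] K) _ _)
  zero_smul φ := LinearMap.ext fun x =>
    (congrArg (φ : A → K) (mul_zero x)).trans (LinearMap.map_zero (φ : A →ₗ[K] K))

theorem smul_apply (a : A) (φ : DualRegular K A) (x : A) : (a • φ) x = φ (x * a) := rfl

instance : IsScalarTower K A (DualRegular K A) where
  smul_assoc r a φ := LinearMap.ext fun x =>
    (congrArg (φ : A → K) (mul_smul_comm r x a)).trans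
      (LinearMap.map_smul (φ : A →ₗ[K] K) r (x * a))

end DualRegular

variable (K : Type*) [Field K] {A : Type*} [Ring A] [Algebra K A] {V : Type*} (e : V → A)

/-- The subspace `M_k = e_k M` of a module `M`. -/
def vertexSpace (M : Type*) [AddCommGroup M] [Module K M] [Module A M] [IsScalarTower K A M]
    (k : V) : Submodule K M :=
  LinearMap.range (Algebra.lsmul K K M (e k))

/-- The multiplicity `[M : S(k)] = dim_K M_k`. -/
def simpleMult (M : Type*) [AddCommGroup M] [Module K M] [Module A M] [IsScalarTower K A M]
    (k : V) : ℕ :=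
  Module.finrank K (vertexSpace K e M k)

/-- The projective module `P(i) = A e_i`. -/
abbrev projModule (i : V) : Submodule A A := Submodule.span A {e i}

/-- The injective module `I(i) = Hom_K(e_i A, K)`, realised as the linear forms `φ` on `A` with
`φ x = φ (e_i x)`. -/
def injModule (i : V) : Submodule A (DualRegular K A) where
  carrier := {φ | ∀ x : A, φ x = φ (e i * x)}
  zero_mem' _ := rfl
  add_mem' {φ ψ} hφ hψ x := congrArg₂ (· + ·) (hφ x) (hψ x)
  smul_mem' a φ hφ x := by
    rw [DualRegular.smul_apply, DualRegular.smul_apply, hφ (x * a), mul_assoc]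

/-- `top M = M / rad M`. -/
abbrev topModule (A : Type*) [Ring A] (M : Type*) [AddCommGroup M] [Module A M] : Type _ :=
  M ⧸ Module.jacobson A M

/-- The socle of `M`: the sum of its simple submodules. -/
def socleModule (A : Type*) [Ring A] (M : Type*) [AddCommGroup M] [Module A M] :
    Submodule A M :=
  sSup {N | IsSimpleModule A N}

/-- The simple module `S(i) = top P(i)`. -/
abbrev simpleModule (i : V) : Type _ := topModule A (projModule e i)

variable [PartialOrder V]

/-- The smallest submodule `U` of `P(i)` such that `[P(i)/U : S(j)] = 0` for all `j` with
`j ≰ i`. -/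
def standardKernel (i : V) : Submodule A (projModule e i) :=
  sInf {U | ∀ j : V, ¬ j ≤ i → simpleMult K e (projModule e i ⧸ U) j = 0}

/-- The standard module `Δ(i)`: the largest factor module of `P(i)` such that
`[Δ(i) : S(j)] = 0` for all `j ≰ i`. -/
abbrev standardModule (i : V) : Type _ := projModule e i ⧸ standardKernel K e i

/-- The costandard module `∇(i)`: the largest submodule of `I(i)` such that
`[∇(i) : S(j)] = 0` for all `j ≰ i`. -/
def costandardModule (i : V) : Submodule A (injModule K e i) :=
  sSup {N | ∀ j : V, ¬ j ≤ i → simpleMult K e N j = 0}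

/-- A `Δ`-good filtration `0 = D_0 ⊆ D_1 ⊆ ⋯ ⊆ D_r = M`: every subquotient `D_{l+1} / D_l` is
isomorphic to a standard module. -/
structure GoodFiltration (M : Type*) [AddCommGroup M] [Module A M] where
  length : ℕ
  sub : Fin (length + 1) → Submodule A M
  monotone_sub : Monotone sub
  sub_zero : sub 0 = ⊥
  sub_last : sub (Fin.last length) = ⊤
  good : ∀ l : Fin length, ∃ i : V, Nonempty
    ((sub l.succ ⧸ (sub l.castSucc).submoduleOf (sub l.succ)) ≃ₗ[A] standardModule K e i)

/-- The number of subquotients of a `Δ`-good filtration isomorphic to `Δ(i)`. -/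
def GoodFiltration.mult {K : Type*} [Field K] {A : Type*} [Ring A] [Algebra K A] {V : Type*}
    {e : V → A} [PartialOrder V] {M : Type*} [AddCommGroup M] [Module A M]
    (F : GoodFiltration K e M) (i : V) : ℕ :=
  Nat.card {l : Fin F.length // Nonempty
    ((F.sub l.succ ⧸ (F.sub l.castSucc).submoduleOf (F.sub l.succ)) ≃ₗ[A] standardModule K e i)}

/-- `M` is `Δ`-good if it has a `Δ`-good filtration. -/
def IsGood (M : Type*) [AddCommGroup M] [Module A M] : Prop := Nonempty (GoodFiltration K e M)

open scoped Classical in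
/-- The multiplicity `(M : Δ(i))` of `Δ(i)` in some `Δ`-good filtration of a `Δ`-good module `M`
(over a quasi-hereditary algebra it does not depend on the filtration). -/
def standardMult (M : Type*) [AddCommGroup M] [Module A M] (i : V) : ℕ :=
  if h : IsGood K e M then (Classical.choice h).mult i else 0

/-- `(A, ≤)` is quasi-hereditary. -/
structure IsQuasiHereditary : Prop where
  standard_self : ∀ i : V, simpleMult K e (standardModule K e i) i = 1
  proj_good : ∀ i : V, IsGood K e (projModule e i)
  proj_mult_eq_zero : ∀ i j : V, ¬ i ≤ j → standardMult K e (projModule e i) j = 0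
  proj_mult_self : ∀ i : V, standardMult K e (projModule e i) i = 1

/-- `(A, ≤)` is 1-quasi-hereditary. -/
structure IsOneQuasiHereditary : Prop extends IsQuasiHereditary K e where
  exists_bot : ∃ o : V, IsBot o
  exists_top : ∃ n : V, IsTop n
  standard_mult : ∀ i j : V, j ≤ i → simpleMult K e (standardModule K e i) j = 1
  proj_mult : ∀ i j : V, j ≤ i → standardMult K e (projModule e j) i = 1
  socle_proj : ∀ o : V, IsBot o → ∀ j : V,
    Nonempty (socleModule A (projModule e j) ≃ₗ[A] simpleModule e o)
  top_inj : ∀ o : V, IsBot o → ∀ j : V,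
    Nonempty (topModule A (injModule K e j) ≃ₗ[A] simpleModule e o)
  standard_embeds : ∀ n : V, IsTop n → ∀ i : V,
    ∃ f : standardModule K e i →ₗ[A] standardModule K e n, Function.Injective f
  costandard_surjects : ∀ n : V, IsTop n → ∀ i : V,
    ∃ f : costandardModule K e n →ₗ[A] costandardModule K e i, Function.Surjective f

end Modules

/-! ## Bound quiver algebras and the paths `p(j,i,k)` -/

section BoundQuiver

variable {K : Type*} [Field K] {V : Type*} [Quiver V] [Fintype V]
  (I : TwoSidedIdeal (PathAlgebra K V))

/-- The algebra `A = KQ / I`. -/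
abbrev BoundQuiverAlgebra : Type _ := I.ringCon.Quotient

/-- The image in `A = KQ / I` of a path of `Q`. -/
def pathClass {j k : V} (p : Quiver.Path j k) : BoundQuiverAlgebra I :=
  I.ringCon.mk' (PathAlgebra.ofPath K p)

/-- The image in `A` of the trivial path at `i`. -/
def vertexIdem (i : V) : BoundQuiverAlgebra I := pathClass I (Quiver.Path.nil : Quiver.Path i i)

/-- A path that starts in `j` as an element of `P(j) = A e_j`. -/
def pathInProj {j k : V} (p : Quiver.Path j k) : projModule (vertexIdem I) j :=
  ⟨pathClass I p, Submodule.mem_span_singleton.2 ⟨pathClass I p, by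
    rw [smul_eq_mul, vertexIdem, pathClass, pathClass, ← map_mul, PathAlgebra.ofPath_mul_ofPath,
      Quiver.Path.nil_comp]⟩⟩

theorem coe_pathInProj {j k : V} (p : Quiver.Path j k) :
    (pathInProj I p : BoundQuiverAlgebra I) = pathClass I p := rfl

/-- A path that ends in `k` as an element of `P(j)_k = e_k A e_j`. -/
def pathInVertexSpace {j k : V} (p : Quiver.Path j k) :
    vertexSpace K (vertexIdem I) (projModule (vertexIdem I) j) k :=
  ⟨pathInProj I p, ⟨pathInProj I p, Subtype.ext <| by
    change vertexIdem I k * pathClass I p = pathClass I p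
    rw [vertexIdem, pathClass, pathClass, ← map_mul, PathAlgebra.ofPath_mul_ofPath,
      Quiver.Path.comp_nil]⟩⟩

end BoundQuiver

section StandardPaths

/-- A path `j_0 → j_1 → ⋯ → j_m` is increasing if `j_0 < j_1 < ⋯ < j_m`. -/
def Quiver.Path.IsIncreasing {V : Type*} [Quiver V] [PartialOrder V] {a : V} :
    {b : V} → Quiver.Path a b → Prop
  | _, .nil => True
  | _, .cons (b := b) (c := c) p _ => p.IsIncreasing ∧ b < c

/-- A path `j_0 → j_1 → ⋯ → j_m` is decreasing if `j_0 > j_1 > ⋯ > j_m`. -/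
def Quiver.Path.IsDecreasing {V : Type*} [Quiver V] [PartialOrder V] {a : V} :
    {b : V} → Quiver.Path a b → Prop
  | _, .nil => True
  | _, .cons (b := b) (c := c) p _ => p.IsDecreasing ∧ c < b

/-- A choice, for all `i ≥ j, k`, of a path `p(j,i,k)`: an increasing path from `j` to `i`
followed by a decreasing path from `i` to `k`. -/
structure StandardPaths (V : Type*) [Quiver V] [PartialOrder V] where
  path : ∀ j i k : V, j ≤ i → k ≤ i → Quiver.Path j k
  exists_eq_comp : ∀ (j i k : V) (hj : j ≤ i) (hk : k ≤ i),
    ∃ (u : Quiver.Path j i) (d : Quiver.Path i k),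
      u.IsIncreasing ∧ d.IsDecreasing ∧ path j i k hj hk = u.comp d

open scoped Classical in
/-- The element `q - ∑_{i ≥ j, k} c_i p(j,i,k)` of `KQ`, for a path `q` from `j` to `k`. -/
def StandardPaths.relation {K : Type*} [Field K] {V : Type*} [Quiver V] [PartialOrder V]
    [Fintype V] (p : StandardPaths V) {j k : V} (q : Quiver.Path j k)
    (c : {i : V // j ≤ i ∧ k ≤ i} → K) : PathAlgebra K V :=
  PathAlgebra.ofPath K q - ∑ i, c i • PathAlgebra.ofPath K (p.path j i k i.2.1 i.2.2)

end StandardPaths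

end

/-! Write `corner K e k j` for e_k A e_j. The good filtration of P(j) has each Δ(i) with i ≥ j
exactly once, so dim e_k A e_j is the number of i ≥ j, k (`finrank_corner`). In particular e_k A e_n
and e_n A e_k are lines when n is the largest vertex.

The embedding Δ(i) ↪ Δ(n) = P(n) is right multiplication by some v_i in e_i A e_n, and ∇(n) ↠ ∇(i)
is dual to left multiplication by some w_i in e_n A e_i. Up to scalars, v_k and w_k span the lines
above. An x in e_k A e_i is killed by v_i exactly when it lies in the sum of the e_k A e_l A e_i
with l > i, and likewise for w_i on the other side. Hence any d with d v_i ≠ 0 spans e_k A e_i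
modulo products through larger vertices, and any u with w_i u ≠ 0 spans e_i A e_j in the same sense.
Descending induction on i shows that the products d_i u_i span e_k A e_j (`corner_le_span_mul`), and
the dimension makes them a basis.

Since I ⊆ R², an arrow b → c is never a combination of products through vertices larger than both
ends. So no arrow of a decreasing path is killed by v, no arrow of an increasing path by w, and the
d and u in p(j,i,k) qualify. Conversely, a path not killed by v_i descends weakly at every arrow;
dropping its loops leaves a decreasing path, and dually for w. This gives existence.

For the ideal, expand each path in the basis. The resulting relations span an ideal J ⊆ I with KQ =
J + span of the p(j,i,k), and these paths are independent modulo I, so J = I. -/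

noncomputable section

/-! ### Additivity of the multiplicities [M : S(k)] -/

section Multiplicity

variable {K : Type*} [Field K] {A : Type*} [Ring A] [Algebra K A] {V : Type*} {e : V → A}
  {M : Type*} [AddCommGroup M] [Module K M] [Module A M] [IsScalarTower K A M]
  {N : Type*} [AddCommGroup N] [Module K N] [Module A N] [IsScalarTower K A N]

instance finite_submodule_of_isScalarTower [Module.Finite K M] (U : Submodule A M) :
    Module.Finite K U :=
  inferInstanceAs (Module.Finite K (U.restrictScalars K))

instance finite_quotient_of_isScalarTower [Module.Finite K M] (U : Submodule A M) :
    Module.Finite K (M ⧸ U) :=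
  Module.Finite.of_surjective (U.mkQ.restrictScalars K) U.mkQ_surjective

theorem mem_vertexSpace_iff {k : V} (he : IsIdempotentElem (e k)) {x : M} :
    x ∈ vertexSpace K e M k ↔ e k • x = x := by
  constructor
  · rintro ⟨y, rfl⟩
    change e k • e k • y = e k • y
    rw [smul_smul, he.eq]
  · exact fun h => ⟨x, h⟩

theorem simpleMult_eq_zero_iff [Module.Finite K M] {k : V} :
    simpleMult K e M k = 0 ↔ ∀ x : M, e k • x = 0 := by
  rw [simpleMult, Submodule.finrank_eq_zero, vertexSpace, LinearMap.range_eq_bot]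
  exact ⟨fun h x => LinearMap.congr_fun h x, fun h => LinearMap.ext h⟩

theorem simpleMult_eq_add_of_surjective [Module.Finite K M] {k : V}
    (he : IsIdempotentElem (e k)) (f : M →ₗ[A] N) (hf : Function.Surjective f) :
    simpleMult K e M k = simpleMult K e (LinearMap.ker f) k + simpleMult K e N k := by
  let g : vertexSpace K e M k →ₗ[K] N := (f.restrictScalars K).domRestrict _
  have h1 : LinearMap.range g = vertexSpace K e N k := by
    ext y
    rw [mem_vertexSpace_iff he]
    constructor
    · rintro ⟨⟨x, hx⟩, rfl⟩
      rw [mem_vertexSpace_iff he] at hx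
      change e k • f x = f x
      rw [← map_smul, hx]
    · intro hy
      obtain ⟨x, rfl⟩ := hf y
      -- Multiplying an arbitrary preimage by the idempotent moves it into the k-component.
      exact ⟨⟨e k • x, x, rfl⟩, (map_smul f _ _).trans hy⟩
  have h2 : LinearMap.ker g ≃ₗ[K] vertexSpace K e (LinearMap.ker f) k :=
    { toFun := fun x => ⟨⟨x.1.1, x.2⟩, (mem_vertexSpace_iff he).2
        (Subtype.ext ((mem_vertexSpace_iff he).1 x.1.2))⟩
      invFun := fun x => ⟨⟨x.1.1, (mem_vertexSpace_iff he).2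
        (congrArg Subtype.val ((mem_vertexSpace_iff he).1 x.2))⟩, x.1.2⟩
      map_add' := fun _ _ => rfl
      map_smul' := fun _ _ => rfl
      left_inv := fun _ => rfl
      right_inv := fun _ => rfl }
  rw [simpleMult, simpleMult, simpleMult, ← h1, ← h2.finrank_eq, add_comm,
    LinearMap.finrank_range_add_finrank_ker]

theorem simpleMult_congr {k : V} (he : IsIdempotentElem (e k)) (f : M ≃ₗ[A] N) :
    simpleMult K e M k = simpleMult K e N k := by
  refine LinearEquiv.finrank_eq
    (LinearEquiv.ofSubmodules (f.restrictScalars K) _ _ ?_)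
  ext y
  rw [mem_vertexSpace_iff he]
  constructor
  · rintro ⟨x, hx, rfl⟩
    have hx' := (mem_vertexSpace_iff he).1 hx
    change e k • f x = f x
    rw [← map_smul, hx']
  · intro hy
    refine ⟨f.symm y, (mem_vertexSpace_iff he).2 ?_, f.apply_symm_apply y⟩
    rw [← map_smul, hy]

theorem simpleMult_eq_add_quotient [Module.Finite K M] {k : V}
    (he : IsIdempotentElem (e k)) (U : Submodule A M) :
    simpleMult K e M k = simpleMult K e U k + simpleMult K e (M ⧸ U) k := by
  rw [simpleMult_eq_add_of_surjective he U.mkQ U.mkQ_surjective,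
    simpleMult_congr he (LinearEquiv.ofEq _ _ U.ker_mkQ)]

end Multiplicity

/-! ### Generators of the kernel of P(i) → Δ(i) -/

section Standard

variable {K : Type*} [Field K] {A : Type*} [Ring A] [Algebra K A] {V : Type*} {e : V → A}

theorem mem_projModule_iff {i : V} (he : IsIdempotentElem (e i)) {x : A} :
    x ∈ projModule e i ↔ x * e i = x := by
  rw [Submodule.mem_span_singleton]
  constructor
  · rintro ⟨a, rfl⟩
    rw [smul_eq_mul, mul_assoc, he.eq]
  · exact fun h => ⟨x, h⟩

/-- The canonical generator of `P(i)`. -/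
def projGen (e : V → A) (i : V) : projModule e i := ⟨e i, Submodule.mem_span_singleton_self _⟩

theorem smul_projGen {i : V} (he : IsIdempotentElem (e i)) (x : projModule e i) :
    (x : A) • projGen e i = x :=
  Subtype.ext ((mem_projModule_iff he).1 x.2)

theorem simpleMult_quotient_eq_zero_iff {M : Type*} [AddCommGroup M] [Module K M] [Module A M]
    [IsScalarTower K A M] [Module.Finite K M] (U : Submodule A M) {k : V} :
    simpleMult K e (M ⧸ U) k = 0 ↔ ∀ x : M, e k • x ∈ U := by
  rw [simpleMult_eq_zero_iff, U.mkQ_surjective.forall]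
  exact forall_congr' fun x => by
    rw [← map_smul, Submodule.mkQ_apply, Submodule.Quotient.mk_eq_zero]

variable [PartialOrder V] [Module.Finite K A]

/-- The l-component of P(i)/U vanishes exactly when U contains e_l P(i), so the infimum is the
submodule these subspaces generate. -/
theorem standardKernel_eq_span (i : V) : standardKernel K e i =
    Submodule.span A {x | ∃ l, ¬ l ≤ i ∧ ∃ y : projModule e i, x = e l • y} := by
  refine le_antisymm (sInf_le fun l hl => ?_) (le_sInf fun U hU => Submodule.span_le.2 ?_)
  · rw [simpleMult_quotient_eq_zero_iff]
    exact fun y => Submodule.subset_span ⟨l, hl, y, rfl⟩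
  · rintro _ ⟨l, hl, y, rfl⟩
    exact (simpleMult_quotient_eq_zero_iff U).1 (hU l hl) y

theorem smul_mem_standardKernel {i l : V} (hl : ¬ l ≤ i) (y : projModule e i) :
    e l • y ∈ standardKernel K e i := by
  rw [standardKernel_eq_span]
  exact Submodule.subset_span ⟨l, hl, y, rfl⟩

theorem simpleMult_standardModule_of_not_le {i l : V} (hl : ¬ l ≤ i) :
    simpleMult K e (standardModule K e i) l = 0 :=
  (simpleMult_quotient_eq_zero_iff _).2 (smul_mem_standardKernel hl)

/-- Thus Δ(n) = P(n), which lets maps into Δ(n) be read as right multiplications. -/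
theorem standardKernel_eq_bot {n : V} (hn : IsTop n) : standardKernel K e n = ⊥ := by
  rw [standardKernel_eq_span, Submodule.span_eq_bot]
  rintro _ ⟨l, hl, -⟩
  exact absurd (hn l) hl

end Standard

/-! ### Dimension counts along filtrations -/

section Filtration

variable {K : Type*} [Field K] {A : Type*} [Ring A] [Algebra K A]
  {M : Type*} [AddCommGroup M] [Module K M] [Module A M] [IsScalarTower K A M]
  {N : Type*} [AddCommGroup N] [Module K N] [Module A N] [IsScalarTower K A N]

theorem finrank_eq_ker_add_of_surjective [Module.Finite K M] (f : M →ₗ[A] N)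
    (hf : Function.Surjective f) :
    Module.finrank K M = Module.finrank K (LinearMap.ker f) + Module.finrank K N := by
  have h := LinearMap.finrank_range_add_finrank_ker (f.restrictScalars K)
  have hr : LinearMap.range (f.restrictScalars K) = ⊤ := LinearMap.range_eq_top.2 hf
  rw [hr, finrank_top] at h
  rw [← h, add_comm]
  rfl

/-- The layer f(D')/f(D) is a quotient of D'/D. -/
theorem finrank_map_le_add_quotient [Module.Finite K M] (f : M →ₗ[A] N)
    {D D' : Submodule A M} (h : D ≤ D') :
    Module.finrank K (D'.map f) ≤
      Module.finrank K (D.map f) + Module.finrank K (D' ⧸ D.submoduleOf D') := by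
  let W := (D.map f).submoduleOf (D'.map f)
  let s : D' →ₗ[A] D'.map f := f.submoduleMap D'
  have hs : Function.Surjective s := f.submoduleMap_surjective D'
  have : Module.Finite K (D'.map f) := Module.Finite.of_surjective (s.restrictScalars K) hs
  let g : (D' ⧸ D.submoduleOf D') →ₗ[A] (D'.map f ⧸ W) :=
    Submodule.mapQ _ W s fun x hx => ⟨x.1, hx, rfl⟩
  have hg : Function.Surjective g := by
    intro y
    obtain ⟨y, rfl⟩ := W.mkQ_surjective y
    obtain ⟨x, rfl⟩ := hs y
    exact ⟨Submodule.Quotient.mk x, rfl⟩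
  rw [finrank_eq_ker_add_of_surjective W.mkQ W.mkQ_surjective, W.ker_mkQ,
    ((Submodule.submoduleOfEquivOfLe (Submodule.map_mono h)).restrictScalars K).finrank_eq]
  exact Nat.add_le_add_left ((g.restrictScalars K).finrank_le_finrank_of_surjective hg) _

theorem Fin.le_sum_of_forall_succ_le {r : ℕ} (f : Fin (r + 1) → ℕ) (g : Fin r → ℕ) (h0 : f 0 = 0)
    (h : ∀ l : Fin r, f l.succ ≤ f l.castSucc + g l) : f (Fin.last r) ≤ ∑ l, g l := by
  induction r with
  | zero => exact h0.le
  | succ r ih =>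
    rw [Fin.sum_univ_castSucc]
    have h1 := ih (fun l => f l.castSucc) (fun l => g l.castSucc) h0 fun l => h l.castSucc
    exact (h (Fin.last r)).trans (Nat.add_le_add_right h1 _)

theorem Fin.eq_sum_of_forall_succ_eq {r : ℕ} (f : Fin (r + 1) → ℕ) (g : Fin r → ℕ) (h0 : f 0 = 0)
    (h : ∀ l : Fin r, f l.succ = f l.castSucc + g l) : f (Fin.last r) = ∑ l, g l := by
  induction r with
  | zero => exact h0
  | succ r ih =>
    rw [Fin.sum_univ_castSucc]
    have h1 := ih (fun l => f l.castSucc) (fun l => g l.castSucc) h0 fun l => h l.castSucc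
    exact (h (Fin.last r)).trans (congrArg (· + g (Fin.last r)) h1)

end Filtration

/-! ### Consequences of the good filtrations of the P(j) -/

section QuasiHereditary

variable {K : Type*} [Field K] {A : Type*} [Ring A] [Algebra K A] {V : Type*} {e : V → A}
  [PartialOrder V]

/-- The submodule of `P(i)` generated by the `e_l P(i)` with `l > i`. -/
def greaterTrace (e : V → A) (i : V) : Submodule A (projModule e i) :=
  Submodule.span A {x | ∃ l, i < l ∧ ∃ y : projModule e i, x = e l • y}

namespace IsOneQuasiHereditary

theorem exists_goodFiltration (hA : IsOneQuasiHereditary K e) (j : V) :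
    ∃ F : GoodFiltration K e (projModule e j), (∀ i, j ≤ i → F.mult i = 1) ∧
      ∀ i, ¬ j ≤ i → F.mult i = 0 := by
  have h : ∀ i, standardMult K e (projModule e j) i =
      (Classical.choice (hA.proj_good j)).mult i := fun i => dif_pos (hA.proj_good j)
  exact ⟨_, fun i hi => (h i).symm.trans (hA.proj_mult i j hi),
    fun i hi => (h i).symm.trans (hA.proj_mult_eq_zero j i hi)⟩

/-- Δ(l) is generated by the class of e_l, so a lift of that generator, multiplied by e_l, generates
D' modulo D. -/
theorem le_sup_of_quotient_equiv_standardModule (he : ∀ i, IsIdempotentElem (e i))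
    {M : Type*} [AddCommGroup M] [Module A M]
    {l : V} {D D' : Submodule A M}
    (f : (D' ⧸ D.submoduleOf D') ≃ₗ[A] standardModule K e l) :
    D' ≤ D ⊔ Submodule.span A {x | ∃ y : M, x = e l • y} := by
  intro x hx
  obtain ⟨y, hy⟩ := Submodule.mkQ_surjective _
    (f.symm (Submodule.Quotient.mk (projGen e l)))
  obtain ⟨a, ha⟩ := Submodule.mkQ_surjective _ (f (Submodule.Quotient.mk ⟨x, hx⟩))
  have h1 : f (Submodule.Quotient.mk ⟨x, hx⟩) =
      f (Submodule.Quotient.mk (((a : A) * e l) • y)) := by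
    rw [Submodule.Quotient.mk_smul, map_smul, ← Submodule.mkQ_apply _ y, hy,
      LinearEquiv.apply_symm_apply, ← ha, Submodule.mkQ_apply, ← Submodule.Quotient.mk_smul,
      (mem_projModule_iff (he l)).1 a.2, smul_projGen (he l)]
  have h2 := (Submodule.Quotient.eq _).1 (f.injective h1)
  rw [← sub_add_cancel x (((a : A) * e l) • (y : M))]
  refine Submodule.add_mem_sup h2 ?_
  rw [mul_smul]
  exact Submodule.smul_mem _ _ (Submodule.subset_span ⟨y, rfl⟩)

variable [Module.Finite K A]

/-- S(a) occurs in Δ(a), and in Δ(b) only if a ≤ b; by symmetry a = b. Hence every layer of a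
filtration has a well-defined index. -/
theorem eq_of_standardModule_equiv (hA : IsOneQuasiHereditary K e)
    (he : ∀ i, IsIdempotentElem (e i)) {a b : V}
    (f : standardModule K e a ≃ₗ[A] standardModule K e b) : a = b := by
  have key : ∀ {a b : V}, (standardModule K e a ≃ₗ[A] standardModule K e b) → a ≤ b := by
    intro a b f
    by_contra h
    have h1 := simpleMult_congr (K := K) (he a) f
    rw [hA.standard_self, simpleMult_standardModule_of_not_le h] at h1
    exact one_ne_zero h1
  exact le_antisymm (key f) (key f.symm)

open scoped Classical in
/-- A good filtration of `P(j)` together with the index of each subquotient. -/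
theorem exists_goodFiltration_index [Fintype V] (hA : IsOneQuasiHereditary K e)
    (he : ∀ i, IsIdempotentElem (e i)) (j : V) :
    ∃ (F : GoodFiltration K e (projModule e j)) (idx : Fin F.length → V),
      (∀ l, Nonempty ((F.sub l.succ ⧸ (F.sub l.castSucc).submoduleOf (F.sub l.succ)) ≃ₗ[A]
        standardModule K e (idx l))) ∧
      (∀ l, j ≤ idx l) ∧ ∀ f : V → ℕ, ∑ l, f (idx l) = ∑ i : {i // j ≤ i}, f i := by
  classical
  obtain ⟨F, h1, h0⟩ := hA.exists_goodFiltration j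
  choose idx hidx using F.good
  have hm : ∀ i, F.mult i = Nat.card {l // idx l = i} := fun i =>
    Nat.card_congr (Equiv.subtypeEquivRight fun l =>
      ⟨fun ⟨g⟩ => hA.eq_of_standardModule_equiv he ((hidx l).some.symm.trans g),
        fun h => h ▸ hidx l⟩)
  have hj : ∀ l, j ≤ idx l := by
    intro l
    by_contra h
    have h2 := (hm _).symm.trans (h0 _ h)
    rw [Nat.card_eq_fintype_card, Fintype.card_eq_zero_iff] at h2
    exact h2.elim ⟨l, rfl⟩
  refine ⟨F, idx, hidx, hj, fun f => ?_⟩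
  -- Multiplicity one says that each fibre of `idx` over an i ≥ j is a single layer.
  have hb : Function.Bijective fun l => (⟨idx l, hj l⟩ : {i // j ≤ i}) := by
    rw [Function.bijective_iff_existsUnique]
    rintro ⟨i, hi⟩
    have h2 := (hm i).symm.trans (h1 i hi)
    obtain ⟨hs, ⟨l, hl⟩⟩ := Nat.card_eq_one_iff_unique.1 h2
    exact ⟨l, Subtype.ext hl, fun l' hl' =>
      congrArg Subtype.val (hs.elim ⟨l', congrArg Subtype.val hl'⟩ ⟨l, hl⟩)⟩
  exact Fintype.sum_bijective _ hb _ _ fun _ => rfl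

/-- Each i ≥ j contributes one layer Δ(i), whose k-component has dimension 1 if k ≤ i and 0
otherwise. -/
theorem simpleMult_projModule [Fintype V] (hA : IsOneQuasiHereditary K e)
    (he : ∀ i, IsIdempotentElem (e i)) (j k : V) :
    simpleMult K e (projModule e j) k = Nat.card {i : V // j ≤ i ∧ k ≤ i} := by
  classical
  obtain ⟨F, idx, hidx, hj, hsum⟩ := hA.exists_goodFiltration_index he j
  have h := Fin.eq_sum_of_forall_succ_eq (r := F.length) (fun l => simpleMult K e (F.sub l) k)
    (fun l => if k ≤ idx l then 1 else 0) ?_ ?_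
  · rw [F.sub_last] at h
    rw [← simpleMult_congr (he k) (Submodule.topEquiv (R := A) (M := projModule e j)), h,
      hsum fun i => if k ≤ i then 1 else 0, Finset.sum_boole, Nat.cast_id, Nat.card_eq_fintype_card,
      ← Fintype.card_subtype]
    exact Fintype.card_congr (Equiv.subtypeSubtypeEquivSubtypeInter _ _)
  · rw [F.sub_zero]
    exact (simpleMult_eq_zero_iff).2 fun x => Subsingleton.elim _ _
  · intro l
    rw [simpleMult_eq_add_quotient (he k) ((F.sub l.castSucc).submoduleOf (F.sub l.succ)),
      simpleMult_congr (he k) (Submodule.submoduleOfEquivOfLe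
        (F.monotone_sub (Fin.castSucc_le_succ l))), simpleMult_congr (he k) (hidx l).some]
    split_ifs with hk
    · rw [hA.standard_mult _ _ hk]
    · rw [simpleMult_standardModule_of_not_le hk]

/-- The kernel is defined by the l ≰ i; the filtration reduces these to l > i. Modulo `greaterTrace`
every layer Δ(l) with l > i dies, and Δ(i) occurs once, so the quotient of P(i) has dimension at
most dim Δ(i). As it maps onto Δ(i), the two agree. -/
theorem standardKernel_eq_greaterTrace [Fintype V] (hA : IsOneQuasiHereditary K e)
    (he : ∀ i, IsIdempotentElem (e i)) (i : V) :
    standardKernel K e i = greaterTrace e i := by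
  classical
  have hle : greaterTrace e i ≤ standardKernel K e i := by
    rw [greaterTrace, standardKernel_eq_span]
    exact Submodule.span_mono fun x ⟨l, hl, h⟩ => ⟨l, hl.not_ge, h⟩
  refine le_antisymm ?_ hle
  obtain ⟨F, idx, hidx, hj, hsum⟩ := hA.exists_goodFiltration_index he i
  have h := Fin.le_sum_of_forall_succ_le (r := F.length)
    (fun l => Module.finrank K ((F.sub l).map (greaterTrace e i).mkQ))
    (fun l => if idx l = i then Module.finrank K (standardModule K e i) else 0) ?_ ?_
  · rw [hsum fun l => if l = i then Module.finrank K (standardModule K e i) else 0,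
      Finset.sum_eq_single ⟨i, le_rfl⟩ (fun b _ hb => if_neg fun h => hb (Subtype.ext h))
        (fun h => absurd (Finset.mem_univ _) h), if_pos rfl, F.sub_last, Submodule.map_top,
      Submodule.range_mkQ] at h
    let g : (projModule e i ⧸ greaterTrace e i) →ₗ[A] standardModule K e i :=
      Submodule.factor hle
    have hg := finrank_eq_ker_add_of_surjective (K := K) g (Submodule.factor_surjective hle)
    have ht : Module.finrank K (⊤ : Submodule A (projModule e i ⧸ greaterTrace e i)) =
      Module.finrank K (projModule e i ⧸ greaterTrace e i) :=
        ((Submodule.topEquiv (R := A)).restrictScalars K).finrank_eq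
    have h0 : Module.finrank K (LinearMap.ker g) = 0 := by omega
    rw [Module.finrank_zero_iff, Submodule.subsingleton_iff_eq_bot] at h0
    intro x hx
    have hx' : (greaterTrace e i).mkQ x ∈ LinearMap.ker g :=
      (Submodule.Quotient.mk_eq_zero _).2 hx
    rw [h0] at hx'
    exact (Submodule.Quotient.mk_eq_zero _).1 hx'
  · rw [F.sub_zero, Submodule.map_bot]
    exact Module.finrank_zero_of_subsingleton
  · intro l
    split_ifs with hl
    · refine (finrank_map_le_add_quotient _
        (F.monotone_sub (Fin.castSucc_le_succ l))).trans (Nat.add_le_add_left ?_ _)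
      exact (((hl ▸ hidx l).some.restrictScalars K).finrank_eq).le
    · rw [add_zero]
      have h1 : (F.sub l.succ).map (greaterTrace e i).mkQ ≤
          (F.sub l.castSucc).map (greaterTrace e i).mkQ := by
        refine (Submodule.map_mono
          (le_sup_of_quotient_equiv_standardModule he (hidx l).some)).trans ?_
        rw [Submodule.map_sup]
        refine sup_le le_rfl ?_
        rw [Submodule.map_le_iff_le_comap, Submodule.span_le]
        rintro _ ⟨y, rfl⟩
        have : e (idx l) • y ∈ greaterTrace e i :=
          Submodule.subset_span ⟨idx l, lt_of_le_of_ne (hj l) (Ne.symm hl), y, rfl⟩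
        rw [SetLike.mem_coe, Submodule.mem_comap, Submodule.mkQ_apply, (Submodule.Quotient.mk_eq_zero _).2 this]
        exact zero_mem _
      exact Submodule.finrank_mono
        (s := ((F.sub l.succ).map (greaterTrace e i).mkQ).restrictScalars K)
        (t := ((F.sub l.castSucc).map (greaterTrace e i).mkQ).restrictScalars K) h1

end IsOneQuasiHereditary

end QuasiHereditary

/-! ### The spaces e_k A e_j and products through larger vertices -/

section Corner

variable (K : Type*) [Field K] {A : Type*} [Ring A] [Algebra K A] {V : Type*} (e : V → A)

/-- The subspace `e_k A e_j` of `A`. -/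
def corner (k j : V) : Submodule K A where
  carrier := {x | e k * x = x ∧ x * e j = x}
  zero_mem' := ⟨mul_zero _, zero_mul _⟩
  add_mem' hx hy := ⟨by rw [mul_add, hx.1, hy.1], by rw [add_mul, hx.2, hy.2]⟩
  smul_mem' c x hx := ⟨by rw [mul_smul_comm, hx.1], by rw [smul_mul_assoc, hx.2]⟩

/-- The sum of the subspaces `e_k A e_l A e_j` with `l ∈ s`. -/
def cornerTrace (s : Set V) (k j : V) : Submodule K A :=
  ⨆ l ∈ s, corner K e k l * corner K e l j

variable {K e}

theorem mul_mem_corner {k i j : V} {x y : A} (hx : x ∈ corner K e k i) (hy : y ∈ corner K e i j) :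
    x * y ∈ corner K e k j :=
  ⟨by rw [← mul_assoc, hx.1], by rw [mul_assoc, hy.2]⟩

theorem idem_mem_corner {i : V} (he : IsIdempotentElem (e i)) : e i ∈ corner K e i i :=
  ⟨he.eq, he.eq⟩

theorem idem_mul_mul_idem_mem_corner (he : ∀ i, IsIdempotentElem (e i)) (k j : V) (x : A) :
    e k * x * e j ∈ corner K e k j :=
  ⟨by rw [← mul_assoc, ← mul_assoc, (he k).eq], by rw [mul_assoc, (he j).eq]⟩

theorem mul_mem_cornerTrace {s : Set V} {k l j : V} (hl : l ∈ s) {x y : A}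
    (hx : x ∈ corner K e k l) (hy : y ∈ corner K e l j) : x * y ∈ cornerTrace K e s k j :=
  Submodule.mem_iSup_of_mem l (Submodule.mem_iSup_of_mem hl (Submodule.mul_mem_mul hx hy))

theorem cornerTrace_le {s : Set V} {k j : V} {W : Submodule K A}
    (h : ∀ l ∈ s, ∀ x ∈ corner K e k l, ∀ y ∈ corner K e l j, x * y ∈ W) :
    cornerTrace K e s k j ≤ W :=
  iSup₂_le fun l hl => Submodule.mul_le.2 (h l hl)

theorem cornerTrace_mul_mem {s : Set V} {k i j : V} {x y : A}
    (hx : x ∈ cornerTrace K e s k i) (hy : y ∈ corner K e i j) :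
    x * y ∈ cornerTrace K e s k j := by
  have h : cornerTrace K e s k i ≤
      (cornerTrace K e s k j).comap (LinearMap.mulRight K y) :=
    cornerTrace_le fun l hl a ha b hb => by
      rw [Submodule.mem_comap, LinearMap.mulRight_apply]
      rw [mul_assoc]
      exact mul_mem_cornerTrace hl ha (mul_mem_corner hb hy)
  exact h hx

theorem mul_cornerTrace_mem {s : Set V} {k i j : V} {x y : A}
    (hx : x ∈ corner K e k i) (hy : y ∈ cornerTrace K e s i j) :
    x * y ∈ cornerTrace K e s k j := by
  have h : cornerTrace K e s i j ≤
      (cornerTrace K e s k j).comap (LinearMap.mulLeft K x) :=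
    cornerTrace_le fun l hl a ha b hb => by
      rw [Submodule.mem_comap, LinearMap.mulLeft_apply]
      rw [← mul_assoc]
      exact mul_mem_cornerTrace hl (mul_mem_corner hx ha) hb
  exact h hy

/-- The subspace `P(j)_k` is identified with `e_k A e_j`. -/
def vertexSpaceEquivCorner (he : ∀ i, IsIdempotentElem (e i)) (k j : V) :
    vertexSpace K e (projModule e j) k ≃ₗ[K] corner K e k j where
  toFun x := ⟨x.1.1, congrArg Subtype.val ((mem_vertexSpace_iff (he k)).1 x.2),
    (mem_projModule_iff (he j)).1 x.1.2⟩
  invFun x := ⟨⟨x.1, (mem_projModule_iff (he j)).2 x.2.2⟩,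
    (mem_vertexSpace_iff (he k)).2 (Subtype.ext x.2.1)⟩
  map_add' _ _ := rfl
  map_smul' _ _ := rfl
  left_inv _ := rfl
  right_inv _ := rfl

/-- Modulo products through vertices larger than i, a product in e_k A e_i · e_i A e_j is a multiple
of d_i u_i; descending induction absorbs the error. Taking i = j and right factor e_j reaches all of
e_k A e_j. -/
theorem corner_le_span_mul [PartialOrder V] [Finite V] (he : ∀ i, IsIdempotentElem (e i))
    {j k : V} {d u : V → A} (hd : ∀ i, d i ∈ corner K e k i)
    (hd0 : ∀ i, ¬ k ≤ i → d i = 0) (hu0 : ∀ i, ¬ j ≤ i → u i = 0)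
    (hdT : ∀ i, ∀ x ∈ corner K e k i, ∃ c : K, x - c • d i ∈ cornerTrace K e (Set.Ioi i) k i)
    (huT : ∀ i, ∀ y ∈ corner K e i j, ∃ c : K, y - c • u i ∈ cornerTrace K e (Set.Ioi i) i j) :
    corner K e k j ≤
      Submodule.span K (Set.range fun i : {i : V // j ≤ i ∧ k ≤ i} => d i * u i) := by
  set S := Submodule.span K (Set.range fun i : {i : V // j ≤ i ∧ k ≤ i} => d i * u i)
  have key : ∀ i, ∀ x ∈ corner K e k i, ∀ y ∈ corner K e i j, x * y ∈ S := by
    intro i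
    induction i using (wellFounded_gt (α := V)).induction with
    | _ i ih =>
    intro x hx y hy
    have hT : cornerTrace K e (Set.Ioi i) k j ≤ S := cornerTrace_le ih
    obtain ⟨c, hc⟩ := hdT i x hx
    obtain ⟨c', hc'⟩ := huT i y hy
    have hdu : d i * u i ∈ S := by
      by_cases h : j ≤ i ∧ k ≤ i
      · exact Submodule.subset_span ⟨⟨i, h⟩, rfl⟩
      · rcases not_and_or.1 h with h | h
        · rw [hu0 i h, mul_zero]
          exact zero_mem _
        · rw [hd0 i h, zero_mul]
          exact zero_mem _
    -- The first two summands factor through larger vertices; the third is a spanning vector or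
    -- zero.
    have hxy : x * y = (x - c • d i) * y + c • (d i * (y - c' • u i)) +
        (c * c') • (d i * u i) := by
      rw [sub_mul, mul_sub, smul_sub, smul_mul_assoc, mul_smul_comm, smul_smul]
      abel
    rw [hxy]
    exact add_mem (add_mem (hT (cornerTrace_mul_mem hc hy))
      (S.smul_mem _ (hT (mul_cornerTrace_mem (hd i) hc')))) (S.smul_mem _ hdu)
  intro x hx
  rw [← hx.2]
  exact key j x hx _ (idem_mem_corner (he j))

end Corner

namespace IsOneQuasiHereditary

variable {K : Type*} [Field K] {A : Type*} [Ring A] [Algebra K A] {V : Type*} {e : V → A}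
  [PartialOrder V] [Module.Finite K A]

/-- The embedding `Δ(i) ↪ Δ(n) = P(n)` is right multiplication by an element of `e_i A e_n`. -/
theorem exists_left_generator (hA : IsOneQuasiHereditary K e) (he : ∀ i, IsIdempotentElem (e i))
    {n : V} (hn : IsTop n) (i : V) : ∃ v ∈ corner K e i n,
      (∀ x : A, x * v = 0 ↔ x • projGen e i ∈ standardKernel K e i) := by
  obtain ⟨f, hf⟩ := hA.standard_embeds n hn i
  obtain ⟨v, hv⟩ := (standardKernel K e n).mkQ_surjective
    (f (Submodule.Quotient.mk (projGen e i)))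
  have hgen : e i • projGen e i = projGen e i := smul_projGen (he i) (projGen e i)
  have hx : ∀ x : A, x • v = 0 ↔ x • projGen e i ∈ standardKernel K e i := by
    intro x
    rw [← Submodule.Quotient.mk_eq_zero, Submodule.Quotient.mk_smul, ← map_eq_zero_iff f hf,
      map_smul, ← hv, Submodule.mkQ_apply, ← Submodule.Quotient.mk_smul,
      Submodule.Quotient.mk_eq_zero, standardKernel_eq_bot hn, Submodule.mem_bot]
  have hv1 : e i • v = v := by
    -- The element e_i - 1 annihilates the generator of P(i), hence also v.
    have := (hx (e i - 1)).2 (by rw [sub_smul, one_smul, hgen, sub_self]; exact zero_mem _)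
    rwa [sub_smul, one_smul, sub_eq_zero] at this
  refine ⟨v, ⟨congrArg Subtype.val hv1, (mem_projModule_iff (he n)).1 v.2⟩, fun x => ?_⟩
  rw [← hx, Subtype.ext_iff]
  rfl

/-- For `k ≤ i` some element of `e_k A e_i` is nonzero in `Δ(i)`. -/
theorem exists_mem_corner_notMem_standardKernel (hA : IsOneQuasiHereditary K e)
    (he : ∀ i, IsIdempotentElem (e i)) {k i : V} (h : k ≤ i) :
    ∃ x ∈ corner K e k i, x • projGen e i ∉ standardKernel K e i := by
  by_contra! hc
  have h1 := hA.standard_mult i k h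
  rw [(simpleMult_quotient_eq_zero_iff _).2] at h1
  · exact zero_ne_one h1
  · intro x
    have := hc (e k * x * e i) (idem_mul_mul_idem_mem_corner he k i _)
    rwa [mul_assoc, (mem_projModule_iff (he i)).1 x.2, mul_smul, smul_projGen (he i)] at this

variable [Fintype V]

theorem finrank_corner (hA : IsOneQuasiHereditary K e) (he : ∀ i, IsIdempotentElem (e i))
    (k j : V) : Module.finrank K (corner K e k j) = Nat.card {i : V // j ≤ i ∧ k ≤ i} := by
  rw [← hA.simpleMult_projModule he, simpleMult, (vertexSpaceEquivCorner he k j).finrank_eq]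

/-- Only i = n satisfies i ≥ n. This is what makes every x v_i with x in e_k A e_i a multiple of
v_k. -/
theorem finrank_corner_top_right (hA : IsOneQuasiHereditary K e)
    (he : ∀ i, IsIdempotentElem (e i)) {n : V} (hn : IsTop n) (k : V) :
    Module.finrank K (corner K e k n) = 1 := by
  rw [hA.finrank_corner he, Nat.card_eq_one_iff_unique]
  exact ⟨⟨fun a b => Subtype.ext ((le_antisymm (hn _) a.2.1).trans
    (le_antisymm (hn _) b.2.1).symm)⟩, ⟨n, le_rfl, hn k⟩⟩

theorem finrank_corner_top_left (hA : IsOneQuasiHereditary K e)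
    (he : ∀ i, IsIdempotentElem (e i)) {n : V} (hn : IsTop n) (j : V) :
    Module.finrank K (corner K e n j) = 1 := by
  rw [hA.finrank_corner he, Nat.card_eq_one_iff_unique]
  exact ⟨⟨fun a b => Subtype.ext ((le_antisymm (hn _) a.2.2).trans
    (le_antisymm (hn _) b.2.2).symm)⟩, ⟨n, hn j, le_rfl⟩⟩

theorem mul_mem_cornerTrace_Ioi_of_mem_standardKernel (hA : IsOneQuasiHereditary K e)
    (he : ∀ i, IsIdempotentElem (e i)) {k i : V} {x : projModule e i}
    (hx : x ∈ standardKernel K e i) (b : A) :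
    e k * (b * (x : A)) ∈ cornerTrace K e (Set.Ioi i) k i := by
  rw [hA.standardKernel_eq_greaterTrace he] at hx
  -- The free left factor b absorbs the scalars from A in the last case.
  induction hx using Submodule.span_induction generalizing b with
  | mem x hx =>
    obtain ⟨l, hl, y, rfl⟩ := hx
    have : e k * (b * (e l * (y : A))) = (e k * b * e l) * (e l * y * e i) := by
      rw [mul_assoc (e l), (mem_projModule_iff (he i)).1 y.2, mul_assoc (e k * b),
        ← mul_assoc (e l) (e l), (he l).eq, mul_assoc]
    rw [Submodule.coe_smul, smul_eq_mul, this]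
    exact mul_mem_cornerTrace hl (idem_mul_mul_idem_mem_corner he _ _ _)
      (idem_mul_mul_idem_mem_corner he _ _ _)
  | zero => simp
  | add x y _ _ hx hy =>
    rw [Submodule.coe_add, mul_add, mul_add]
    exact add_mem (hx b) (hy b)
  | smul a x _ hx =>
    rw [Submodule.coe_smul, smul_eq_mul, ← mul_assoc b]
    exact hx (b * a)

theorem mem_cornerTrace_Ioi_of_mem_standardKernel (hA : IsOneQuasiHereditary K e)
    (he : ∀ i, IsIdempotentElem (e i)) {k i : V} {x : A} (hx : x ∈ corner K e k i)
    (h : x • projGen e i ∈ standardKernel K e i) : x ∈ cornerTrace K e (Set.Ioi i) k i := by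
  have := hA.mul_mem_cornerTrace_Ioi_of_mem_standardKernel he (k := k) h 1
  change e k * (1 * (x * e i)) ∈ _ at this
  rwa [one_mul, hx.2, hx.1] at this

theorem corner_le_cornerTrace_Ioi_right (hA : IsOneQuasiHereditary K e)
    (he : ∀ i, IsIdempotentElem (e i)) {k i : V} (h : ¬ k ≤ i) :
    corner K e k i ≤ cornerTrace K e (Set.Ioi i) k i := fun x hx => by
  refine hA.mem_cornerTrace_Ioi_of_mem_standardKernel he hx ?_
  rw [← hx.1, mul_smul]
  exact smul_mem_standardKernel h _

/-- Descending induction on l. If i ≤ l, then l itself is a vertex above i. Otherwise i ≰ l, and the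
right-hand version factors through some s > l, where again s ≰ i. This transfers the reduction from
l ≰ i to l > i to the costandard side without a filtration by costandard modules. -/
theorem corner_le_cornerTrace_Ioi_left (hA : IsOneQuasiHereditary K e)
    (he : ∀ i, IsIdempotentElem (e i)) {i l : V} (h : ¬ l ≤ i) :
    corner K e i l ≤ cornerTrace K e (Set.Ioi i) i l := by
  induction l using (wellFounded_gt (α := V)).induction with
  | _ l ih =>
  by_cases hil : i ≤ l
  · intro x hx
    rw [← hx.2]
    exact mul_mem_cornerTrace (lt_of_le_not_ge hil h) hx (idem_mem_corner (he l))
  · exact (hA.corner_le_cornerTrace_Ioi_right he hil).trans (cornerTrace_le fun s hs x hx y hy =>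
      cornerTrace_mul_mem (ih s hs (fun hsi => h (le_trans (le_of_lt hs) hsi)) hx) hy)

theorem cornerTrace_not_le_le_cornerTrace_Ioi (hA : IsOneQuasiHereditary K e)
    (he : ∀ i, IsIdempotentElem (e i)) (i j : V) :
    cornerTrace K e {l | ¬ l ≤ i} i j ≤ cornerTrace K e (Set.Ioi i) i j :=
  cornerTrace_le fun _ hl _ hx _ hy =>
    cornerTrace_mul_mem (hA.corner_le_cornerTrace_Ioi_left he hl hx) hy

end IsOneQuasiHereditary

/-! ### Dualising the surjections ∇(n) ↠ ∇(i) -/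

section Costandard

variable {K : Type*} [Field K] {A : Type*} [Ring A] [Algebra K A] {V : Type*} {e : V → A}

instance [Module.Finite K A] : Module.Finite K (DualRegular K A) := inferInstanceAs (Module.Finite K (A →ₗ[K] K))

theorem DualRegular.ext {φ ψ : DualRegular K A} (h : ∀ x : A, φ x = ψ x) : φ = ψ :=
  LinearMap.ext h

theorem eq_of_forall_linearForm_eq {x y : A} (h : ∀ φ : A →ₗ[K] K, φ x = φ y) : x = y :=
  sub_eq_zero.1 ((Module.forall_dual_apply_eq_zero_iff K _).1 fun φ => by
    rw [map_sub, h, sub_self])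

variable [PartialOrder V]

/-- The linear forms in `I(i)` that vanish on `A e_l A` for all `l ≰ i`. -/
def vanishingForms (K : Type*) [Field K] {A : Type*} [Ring A] [Algebra K A] {V : Type*}
    (e : V → A) [PartialOrder V] (i : V) : Submodule A (injModule K e i) where
  carrier := {φ | ∀ l, ¬ l ≤ i → ∀ x y : A, φ.1 (x * e l * y) = 0}
  zero_mem' _ _ _ _ := rfl
  add_mem' {_ _} hφ hψ l hl x y :=
    (congrArg₂ (· + ·) (hφ l hl x y) (hψ l hl x y)).trans (add_zero 0)
  smul_mem' a φ hφ l hl x y :=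
    (congrArg (φ.1 : A → K) (mul_assoc (x * e l) y a)).trans (hφ l hl x (y * a))

theorem costandardModule_eq_vanishingForms [Module.Finite K A] (i : V) :
    costandardModule K e i = vanishingForms K e i := by
  refine le_antisymm (sSup_le fun N hN φ hφ l hl x y => ?_) (le_sSup fun l hl => ?_)
  · have h := simpleMult_eq_zero_iff.1 (hN l hl) (y • ⟨φ, hφ⟩)
    have h1 : (e l • y • φ.1 : DualRegular K A) = 0 :=
      congrArg (fun z : N => (z : injModule K e i).1) h
    have h2 : (e l • y • φ.1 : DualRegular K A) x = 0 := by rw [h1]; rfl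
    rwa [DualRegular.smul_apply, DualRegular.smul_apply] at h2
  · refine simpleMult_eq_zero_iff.2 fun φ => Subtype.ext (Subtype.ext (DualRegular.ext fun x => ?_))
    have := φ.2 l hl x 1
    rwa [mul_one] at this

theorem mem_costandardModule_iff [Module.Finite K A] {i : V} {φ : injModule K e i} :
    φ ∈ costandardModule K e i ↔ ∀ l, ¬ l ≤ i → ∀ x y : A, φ.1 (x * e l * y) = 0 := by
  rw [costandardModule_eq_vanishingForms]
  rfl

/-- The linear form `x ↦ φ (e_n x)`, for a largest element `n`. -/
def topForm [Module.Finite K A] {n : V} (he : IsIdempotentElem (e n)) (hn : IsTop n) :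
    (A →ₗ[K] K) →ₗ[K] costandardModule K e n where
  toFun φ := ⟨⟨φ ∘ₗ LinearMap.mulLeft K (e n), fun x =>
      congrArg φ (show e n * x = e n * (e n * x) by rw [← mul_assoc, he.eq])⟩, by
    exact mem_costandardModule_iff.2 fun l hl => absurd (hn l) hl⟩
  map_add' _ _ := rfl
  map_smul' _ _ := rfl

/-- The surjection `∇(n) ↠ ∇(i)` is dual to left multiplication by an element of `e_n A e_i`. -/
theorem IsOneQuasiHereditary.exists_right_generator [Module.Finite K A]
    (hA : IsOneQuasiHereditary K e)
    (he : ∀ i, IsIdempotentElem (e i)) {n : V} (hn : IsTop n) (i : V) : ∃ w ∈ corner K e n i,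
      ∀ j, (∀ y ∈ cornerTrace K e {l | ¬ l ≤ i} i j, w * y = 0) ∧
        ∀ y ∈ corner K e i j, w * y = 0 → y ∈ cornerTrace K e {l | ¬ l ≤ i} i j := by
  obtain ⟨g, hg⟩ := hA.costandard_surjects n hn i
  -- F lies in the double dual of the finite-dimensional space A, so it is evaluation at an element
  -- w.
  let F : (A →ₗ[K] K) →ₗ[K] K :=
    { toFun := fun φ => (g (topForm (he n) hn φ)).1.1 1
      map_add' := fun φ ψ => by rw [map_add, map_add]; rfl
      map_smul' := fun c φ => by
        rw [map_smul]
        exact congrArg (fun z : costandardModule K e i => (z.1.1 : DualRegular K A) 1)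
          ((g.restrictScalars K).map_smul c (topForm (he n) hn φ)) }
  let w : A := (Module.evalEquiv K A).symm F
  have hw : ∀ φ : A →ₗ[K] K, φ w = (g (topForm (he n) hn φ)).1.1 1 := fun φ =>
    Module.apply_evalEquiv_symm_apply K A φ F
  -- The A-linearity of g extends the formula for φ(w) from 1 to every y.
  have hwy : ∀ (φ : A →ₗ[K] K) (y : A), φ (w * y) = (g (topForm (he n) hn φ)).1.1 y := by
    intro φ y
    have h1 : topForm (he n) hn (φ ∘ₗ LinearMap.mulRight K y) = y • topForm (he n) hn φ :=
      Subtype.ext (Subtype.ext (DualRegular.ext fun x =>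
        congrArg φ (mul_assoc (e n) x y)))
    have h2 := hw (φ ∘ₗ LinearMap.mulRight K y)
    rw [h1, map_smul] at h2
    refine h2.trans ?_
    change (g (topForm (he n) hn φ)).1.1 (1 * y) = _
    rw [one_mul]
  have hw1 : e n * w = w := by
    refine eq_of_forall_linearForm_eq (K := K) fun φ => ?_
    have h1 : topForm (he n) hn (φ ∘ₗ LinearMap.mulLeft K (e n)) = topForm (he n) hn φ :=
      Subtype.ext (Subtype.ext (DualRegular.ext fun x =>
        congrArg φ (show e n * (e n * x) = e n * x by rw [← mul_assoc, (he n).eq])))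
    have h2 := hw (φ ∘ₗ LinearMap.mulLeft K (e n))
    rw [h1, ← hw] at h2
    exact h2
  have hw2 : w * e i = w := by
    refine eq_of_forall_linearForm_eq (K := K) fun φ => ?_
    have h1 := (g (topForm (he n) hn φ)).1.2 1
    rw [mul_one] at h1
    rw [hwy, hw, h1]
  refine ⟨w, ⟨hw1, hw2⟩, fun j => ⟨fun y hy => ?_, fun y hy hwy0 => ?_⟩⟩
  · refine (Module.forall_dual_apply_eq_zero_iff K _).1 fun φ => ?_
    rw [hwy]
    have hψ := mem_costandardModule_iff.1 (g (topForm (he n) hn φ)).2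
    have hle : cornerTrace K e {l | ¬ l ≤ i} i j ≤
        LinearMap.ker ((g (topForm (he n) hn φ)).1.1 : A →ₗ[K] K) :=
      cornerTrace_le fun l hl x hx z hz => by
        have := hψ l hl x z
        rwa [hx.2] at this
    exact hle hy
  · by_contra hyT
    -- A form θ separating y from the trace, cut down to e_i A e_j, lies in ∇(i). By surjectivity it
    -- comes from some φ, and then φ(w y) = θ(y) ≠ 0 contradicts w y = 0.
    obtain ⟨θ, hθ, hθT⟩ := Submodule.exists_le_ker_of_notMem hyT
    let ψ : A →ₗ[K] K := θ ∘ₗ LinearMap.mulLeft K (e i) ∘ₗ LinearMap.mulRight K (e j)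
    have hψ : ∀ x, ψ x = θ (e i * (x * e j)) := fun _ => rfl
    have hψ1 : ∀ x, ψ x = ψ (e i * x) := fun x => by
      rw [hψ, hψ, mul_assoc, ← mul_assoc (e i) (e i), (he i).eq]
    have hψ2 : (⟨ψ, hψ1⟩ : injModule K e i) ∈ costandardModule K e i := by
      refine mem_costandardModule_iff.2 fun l hl x z => hθT ?_
      have : e i * (x * e l * z * e j) = (e i * x * e l) * (e l * z * e j) := by
        simp only [mul_assoc]
        rw [← mul_assoc (e l) (e l), (he l).eq]
      change e i * (x * e l * z * e j) ∈ _
      rw [this]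
      exact mul_mem_cornerTrace hl (idem_mul_mul_idem_mem_corner he _ _ _)
        (idem_mul_mul_idem_mem_corner he _ _ _)
    obtain ⟨φ, hφ⟩ := hg ⟨_, hψ2⟩
    have hφ' : topForm (he n) hn (φ.1.1 : A →ₗ[K] K) = φ :=
      Subtype.ext (Subtype.ext (DualRegular.ext fun x => (φ.1.2 x).symm))
    have h0 := hwy (φ.1.1 : A →ₗ[K] K) y
    rw [hφ', hφ, hwy0] at h0
    refine hθ ?_
    have h1 : ψ y = 0 := h0.symm.trans (LinearMap.map_zero (φ.1.1 : A →ₗ[K] K))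
    rwa [hψ, hy.2, hy.1] at h1

end Costandard

/-! ### The elements v_i and w_i, and spanning families built from them -/

section Families

variable (K : Type*) [Field K] {A : Type*} [Ring A] [Algebra K A] {V : Type*} (e : V → A)
  [PartialOrder V]

/-- Right multiplication by `v i` induces an embedding of `Δ(i)` into `A e_n`, all of whose
components are spanned by the `v k`. -/
structure IsStandardFamily (n : V) (v : V → A) : Prop where
  mem : ∀ i, v i ∈ corner K e i n
  ne_zero : ∀ i, v i ≠ 0
  exists_smul : ∀ k, ∀ x ∈ corner K e k n, ∃ c : K, c • v k = x
  mul_eq_zero_of_mem : ∀ k i, ∀ x ∈ cornerTrace K e {l | ¬ l ≤ i} k i, x * v i = 0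
  mem_of_mul_eq_zero : ∀ k i, ∀ x ∈ corner K e k i, x * v i = 0 →
    x ∈ cornerTrace K e (Set.Ioi i) k i
  exists_mul_ne_zero : ∀ k i, k ≤ i → ∃ x ∈ corner K e k i, x * v i ≠ 0

/-- Left multiplication by `w i` induces an embedding of the dual of `∇(i)` into `e_n A`, all of
whose components are spanned by the `w k`. -/
structure IsCostandardFamily (n : V) (w : V → A) : Prop where
  mem : ∀ i, w i ∈ corner K e n i
  ne_zero : ∀ i, w i ≠ 0
  exists_smul : ∀ k, ∀ x ∈ corner K e n k, ∃ c : K, c • w k = x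
  mul_eq_zero_of_mem : ∀ i j, ∀ y ∈ cornerTrace K e {l | ¬ l ≤ i} i j, w i * y = 0
  mem_of_mul_eq_zero : ∀ i j, ∀ y ∈ corner K e i j, w i * y = 0 →
    y ∈ cornerTrace K e (Set.Ioi i) i j

variable {K e} {n : V} {v w : V → A}

theorem IsStandardFamily.mul_eq_zero (hv : IsStandardFamily K e n v)
    (he : ∀ i, IsIdempotentElem (e i)) {k i : V} (h : ¬ k ≤ i) {x : A}
    (hx : x ∈ corner K e k i) : x * v i = 0 :=
  hv.mul_eq_zero_of_mem k i x (hx.1 ▸ mul_mem_cornerTrace h (idem_mem_corner (he k)) hx)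

theorem IsCostandardFamily.mul_eq_zero (hw : IsCostandardFamily K e n w)
    (he : ∀ i, IsIdempotentElem (e i)) {i j : V} (h : ¬ j ≤ i) {y : A}
    (hy : y ∈ corner K e i j) : w i * y = 0 :=
  hw.mul_eq_zero_of_mem i j y (hy.2 ▸ mul_mem_cornerTrace h hy (idem_mem_corner (he j)))

/-- Both x v_i and d v_i lie on the line spanned by v_k, so some x - c d is killed by v_i when d v_i
≠ 0. If d v_i = 0, then x v_i = 0 too and c = 0 serves. -/
theorem IsStandardFamily.exists_sub_smul_mem (hv : IsStandardFamily K e n v) {k i : V} {d : A}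
    (hd : d ∈ corner K e k i) (h : d * v i = 0 → ∀ x ∈ corner K e k i, x * v i = 0)
    {x : A} (hx : x ∈ corner K e k i) :
    ∃ c : K, x - c • d ∈ cornerTrace K e (Set.Ioi i) k i := by
  by_cases h0 : d * v i = 0
  · exact ⟨0, by rw [zero_smul, sub_zero]; exact hv.mem_of_mul_eq_zero _ _ _ hx (h h0 x hx)⟩
  · obtain ⟨a, ha⟩ := hv.exists_smul k _ (mul_mem_corner hd (hv.mem i))
    obtain ⟨b, hb⟩ := hv.exists_smul k _ (mul_mem_corner hx (hv.mem i))
    have ha0 : a ≠ 0 := fun h => h0 (by rw [← ha, h, zero_smul])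
    refine ⟨b / a, hv.mem_of_mul_eq_zero _ _ _ (sub_mem hx (Submodule.smul_mem _ _ hd)) ?_⟩
    rw [sub_mul, smul_mul_assoc, ← ha, ← hb, smul_smul, div_mul_cancel₀ _ ha0, sub_self]

theorem IsCostandardFamily.exists_sub_smul_mem (hw : IsCostandardFamily K e n w) {i j : V} {u : A}
    (hu : u ∈ corner K e i j) (h : w i * u = 0 → ∀ y ∈ corner K e i j, w i * y = 0)
    {y : A} (hy : y ∈ corner K e i j) :
    ∃ c : K, y - c • u ∈ cornerTrace K e (Set.Ioi i) i j := by
  by_cases h0 : w i * u = 0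
  · exact ⟨0, by rw [zero_smul, sub_zero]; exact hw.mem_of_mul_eq_zero _ _ _ hy (h h0 y hy)⟩
  · obtain ⟨a, ha⟩ := hw.exists_smul j _ (mul_mem_corner (hw.mem i) hu)
    obtain ⟨b, hb⟩ := hw.exists_smul j _ (mul_mem_corner (hw.mem i) hy)
    have ha0 : a ≠ 0 := fun h => h0 (by rw [← ha, h, zero_smul])
    refine ⟨b / a, hw.mem_of_mul_eq_zero _ _ _ (sub_mem hy (Submodule.smul_mem _ _ hu)) ?_⟩
    rw [mul_sub, mul_smul_comm, ← ha, ← hb, smul_smul, div_mul_cancel₀ _ ha0, sub_self]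

/-- The weaker condition on the w-side, allowing w_i u_i = 0 when w_i kills the whole corner, is
what permits the use in `exists_mul_ne_zero`, where nonvanishing is still to be proved. -/
theorem corner_le_span_mul_of_families [Finite V] (he : ∀ i, IsIdempotentElem (e i))
    (hv : IsStandardFamily K e n v) (hw : IsCostandardFamily K e n w) {j k : V} {d u : V → A}
    (hd : ∀ i, d i ∈ corner K e k i) (hu : ∀ i, u i ∈ corner K e i j)
    (hd0 : ∀ i, ¬ k ≤ i → d i = 0) (hu0 : ∀ i, ¬ j ≤ i → u i = 0)
    (hdv : ∀ i, k ≤ i → d i * v i ≠ 0)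
    (hwu : ∀ i, j ≤ i → w i * u i = 0 → ∀ y ∈ corner K e i j, w i * y = 0) :
    corner K e k j ≤
      Submodule.span K (Set.range fun i : {i : V // j ≤ i ∧ k ≤ i} => d i * u i) :=
  corner_le_span_mul he hd hd0 hu0
    (fun i _ hx => hv.exists_sub_smul_mem (hd i) (fun h _ hx => by
      by_cases hk : k ≤ i
      · exact absurd h (hdv i hk)
      · exact hv.mul_eq_zero he hk hx) hx)
    (fun i _ hy => hw.exists_sub_smul_mem (hu i) (fun h y hy => by
      by_cases hj : j ≤ i
      · exact hwu i hj h y hy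
      · exact hw.mul_eq_zero he hj hy) hy)

namespace IsOneQuasiHereditary

variable [Module.Finite K A]

theorem smul_projGen_mem_standardKernel {k i : V} {x : A}
    (hx : x ∈ cornerTrace K e {l | ¬ l ≤ i} k i) : x • projGen e i ∈ standardKernel K e i := by
  have h : cornerTrace K e {l | ¬ l ≤ i} k i ≤
      ((standardKernel K e i).restrictScalars K).comap
        ((LinearMap.toSpanSingleton A _ (projGen e i)).restrictScalars K) :=
    cornerTrace_le fun l hl a _ b hb => by
      change (a * b) • projGen e i ∈ standardKernel K e i
      rw [← hb.1, mul_smul, mul_smul]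
      exact Submodule.smul_mem _ _ (smul_mem_standardKernel hl _)
  exact h hx

/-- Otherwise the generator of Δ(i) would be zero, contrary to [Δ(i) : S(i)] = 1. This gives w_i ≠
0. -/
theorem idem_notMem_cornerTrace (hA : IsOneQuasiHereditary K e)
    (he : ∀ i, IsIdempotentElem (e i)) (i : V) : e i ∉ cornerTrace K e {l | ¬ l ≤ i} i i := by
  intro h
  have h1 := smul_projGen_mem_standardKernel h
  obtain ⟨x, hx, hxk⟩ := hA.exists_mem_corner_notMem_standardKernel he (le_refl i)
  refine hxk ?_
  rw [← hx.2, mul_smul]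
  exact Submodule.smul_mem _ _ h1

variable [Fintype V]

theorem exists_isStandardFamily (hA : IsOneQuasiHereditary K e)
    (he : ∀ i, IsIdempotentElem (e i)) (hn : IsTop n) : ∃ v : V → A, IsStandardFamily K e n v := by
  choose v hv hvx using fun i => hA.exists_left_generator he hn i
  have hx : ∀ k i, k ≤ i → ∃ x ∈ corner K e k i, x * v i ≠ 0 := fun k i h => by
    obtain ⟨x, hx, hxk⟩ := hA.exists_mem_corner_notMem_standardKernel he h
    exact ⟨x, hx, fun h0 => hxk ((hvx i x).1 h0)⟩
  have h0 : ∀ i, v i ≠ 0 := fun i h => by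
    obtain ⟨x, -, hxv⟩ := hx i i le_rfl
    exact hxv (by rw [h, mul_zero])
  refine ⟨v, hv, h0, fun k x hx => ?_, fun k i x hx => ?_, fun k i x hx h => ?_, hx⟩
  · obtain ⟨c, hc⟩ := (finrank_eq_one_iff_of_nonzero' (⟨v k, hv k⟩ : corner K e k n)
      (fun h => h0 k (congrArg Subtype.val h))).1 (hA.finrank_corner_top_right he hn k) ⟨x, hx⟩
    exact ⟨c, congrArg Subtype.val hc⟩
  · exact (hvx i x).2 (smul_projGen_mem_standardKernel hx)
  · exact hA.mem_cornerTrace_Ioi_of_mem_standardKernel he hx ((hvx i x).1 h)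

theorem exists_isCostandardFamily (hA : IsOneQuasiHereditary K e)
    (he : ∀ i, IsIdempotentElem (e i)) (hn : IsTop n) :
    ∃ w : V → A, IsCostandardFamily K e n w := by
  choose w hw hwy using fun i => hA.exists_right_generator he hn i
  have h0 : ∀ i, w i ≠ 0 := fun i h => hA.idem_notMem_cornerTrace he i
    ((hwy i i).2 _ (idem_mem_corner (he i)) (by rw [h, zero_mul]))
  refine ⟨w, hw, h0, fun k x hx => ?_, fun i j => (hwy i j).1, fun i j y hy h =>
    hA.cornerTrace_not_le_le_cornerTrace_Ioi he i j ((hwy i j).2 y hy h)⟩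
  obtain ⟨c, hc⟩ := (finrank_eq_one_iff_of_nonzero' (⟨w k, hw k⟩ : corner K e n k)
    (fun h => h0 k (congrArg Subtype.val h))).1 (hA.finrank_corner_top_left he hn k) ⟨x, hx⟩
  exact ⟨c, congrArg Subtype.val hc⟩

/-- By comparing dimensions, a spanning family of `e_k A e_j` indexed by the `i ≥ j, k` is
linearly independent. -/
theorem linearIndependent_of_corner_eq_span (hA : IsOneQuasiHereditary K e)
    (he : ∀ i, IsIdempotentElem (e i)) {j k : V} {f : {i : V // j ≤ i ∧ k ≤ i} → A}
    (hf : Submodule.span K (Set.range f) = corner K e k j) : LinearIndependent K f := by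
  classical
  rw [linearIndependent_iff_card_eq_finrank_span, Set.finrank, hf, hA.finrank_corner he,
    Nat.card_eq_fintype_card]

/-- The multiplicities of ∇(i) are not among the hypotheses, so a dimension count replaces them. If
w_i killed e_i A e_j, then u_i = 0 would be allowed in a spanning family of e_i A e_j of the right
size, which must be linearly independent. -/
theorem exists_mul_ne_zero (hA : IsOneQuasiHereditary K e) (he : ∀ i, IsIdempotentElem (e i))
    (hv : IsStandardFamily K e n v) (hw : IsCostandardFamily K e n w) {i j : V} (hji : j ≤ i) :
    ∃ y ∈ corner K e i j, w i * y ≠ 0 := by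
  classical
  by_contra! hc
  choose! d hd hdv using hv.exists_mul_ne_zero i
  -- Take y = 0 precisely where w_l kills the whole corner, as it does for j ≰ l and, by assumption,
  -- for l = i.
  have hu : ∀ l, ∃ y ∈ corner K e l j, w l * y = 0 → y = 0 ∧ ∀ z ∈ corner K e l j, w l * z = 0 := by
    intro l
    by_cases h : ∃ y ∈ corner K e l j, w l * y ≠ 0
    · obtain ⟨y, hy, hy0⟩ := h
      exact ⟨y, hy, fun h => absurd h hy0⟩
    · push Not at h
      exact ⟨0, zero_mem _, fun _ => ⟨rfl, h⟩⟩
  choose u hu hu0 using hu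
  have hle := corner_le_span_mul_of_families (j := j) (k := i) he hv hw
    (d := fun l => if i ≤ l then d l else 0) (u := u)
    (fun l => by
      split_ifs with h
      · exact hd l h
      · exact zero_mem _) hu (fun l h => if_neg h)
    (fun l h => (hu0 l (hw.mul_eq_zero he h (hu l))).1)
    (fun l h => by rw [if_pos h]; exact hdv l h) (fun l _ h => (hu0 l h).2)
  have hli := hA.linearIndependent_of_corner_eq_span he (le_antisymm (Submodule.span_le.2 (by
    rintro _ ⟨l, rfl⟩
    exact mul_mem_corner (by rw [if_pos l.2.2]; exact hd l l.2.2) (hu l))) hle)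
  refine hli.ne_zero ⟨i, hji, le_rfl⟩ ?_
  change _ * u i = 0
  rw [(hu0 i (hc _ (hu i))).1, mul_zero]

end IsOneQuasiHereditary

end Families

/-! ### Paths and their lengths in KQ -/

section PathAlgebraLemmas

variable {K : Type*} [Field K] {V : Type*} [Quiver V]

namespace PathAlgebra

theorem mem_of_ofPath_mem {S : Submodule K (PathAlgebra K V)}
    (h : ∀ (j k : V) (p : Quiver.Path j k), ofPath K p ∈ S) (z : PathAlgebra K V) : z ∈ S := by
  have : S.mkQ = 0 := hom_ext K fun j k p => (Submodule.Quotient.mk_eq_zero _).2 (h j k p)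
  exact (Submodule.Quotient.mk_eq_zero _).1 (LinearMap.congr_fun this z)

theorem le_length_of_ofPath_mem_arrowIdealPow {m : ℕ} {j k : V} {p : Quiver.Path j k}
    (h : ofPath K p ∈ arrowIdealPow K (V := V) m) : m ≤ p.length := by
  by_contra hlt
  -- The coefficient at p vanishes on all paths longer than p.
  let f : PathAlgebra K V →ₗ[K] K :=
    (Finsupp.lapply (⟨j, k, p⟩ : QPath V) : (QPath V →₀ K) →ₗ[K] K)
  have hle : arrowIdealPow K (V := V) m ≤ LinearMap.ker f := by
    refine Submodule.span_le.2 ?_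
    rintro _ ⟨a, b, q, hq, rfl⟩
    refine Finsupp.single_eq_of_ne fun h => ?_
    have h2 : q.length = p.length := congrArg (fun x : QPath V => x.2.2.length) h.symm
    omega
  have h1 : (1 : K) = 0 := Finsupp.single_eq_same.symm.trans (hle h)
  exact one_ne_zero h1

theorem finite_setOf_length_eq [Finite V] [∀ i j : V, Finite (i ⟶ j)] (m : ℕ) :
    {x : QPath V | x.2.2.length = m}.Finite := by
  induction m with
  | zero =>
    refine (Set.finite_range fun i : V => (⟨i, i, Quiver.Path.nil⟩ : QPath V)).subset ?_
    rintro ⟨j, k, p⟩ hp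
    cases p with
    | nil => exact ⟨_, rfl⟩
    | cons p a => exact absurd hp (Nat.succ_ne_zero _)
  | succ m ih =>
    have : Finite {x : QPath V | x.2.2.length = m} := ih
    refine (Set.finite_range fun y : (Σ x : {x : QPath V | x.2.2.length = m}, Σ c : V,
      (x.1.2.1 ⟶ c)) => (⟨y.1.1.1, y.2.1, y.1.1.2.2.cons y.2.2⟩ : QPath V)).subset ?_
    rintro ⟨j, k, p⟩ hp
    cases p with
    | nil => exact absurd hp.symm (Nat.succ_ne_zero _)
    | cons p a => exact ⟨⟨⟨⟨j, _, p⟩, Nat.succ.inj hp⟩, _, a⟩, rfl⟩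

end PathAlgebra

end PathAlgebraLemmas

/-! ### Paths in A = KQ/I and the use of admissibility -/

section BoundQuiverLemmas

open PathAlgebra

variable {K : Type*} [Field K] {V : Type*} [Quiver V] [Fintype V]
  (I : TwoSidedIdeal (PathAlgebra K V))

/-- The projection `KQ → KQ / I` as a linear map. -/
def quotientLinearMap : PathAlgebra K V →ₗ[K] BoundQuiverAlgebra I where
  toFun := I.ringCon.mk'
  map_add' := map_add _
  map_smul' _ _ := rfl

theorem quotientLinearMap_surjective : Function.Surjective (quotientLinearMap I) :=
  I.ringCon.mk'_surjective

variable {I}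

theorem quotientLinearMap_eq_zero_iff {z : PathAlgebra K V} :
    quotientLinearMap I z = 0 ↔ z ∈ I := by
  rw [TwoSidedIdeal.mem_iff]
  exact RingCon.eq _

theorem mem_of_pathClass_mem {S : Submodule K (BoundQuiverAlgebra I)}
    (h : ∀ (j k : V) (p : Quiver.Path j k), pathClass I p ∈ S) (x : BoundQuiverAlgebra I) :
    x ∈ S := by
  obtain ⟨z, rfl⟩ := quotientLinearMap_surjective I x
  exact mem_of_ofPath_mem (S := S.comap (quotientLinearMap I)) h z

theorem pathClass_comp {a b c : V} (q : Quiver.Path a b) (p : Quiver.Path b c) :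
    pathClass I (q.comp p) = pathClass I p * pathClass I q := by
  rw [pathClass, pathClass, pathClass, ← map_mul, ofPath_mul_ofPath]

theorem pathClass_mul_of_ne {a b c d : V} (q : Quiver.Path a b) (p : Quiver.Path c d)
    (h : b ≠ c) : pathClass I p * pathClass I q = 0 := by
  rw [pathClass, pathClass, ← map_mul, ofPath_mul_ofPath_of_ne K p q h, map_zero]

theorem pathClass_cons {a b c : V} (p : Quiver.Path a b) (f : b ⟶ c) :
    pathClass I (p.cons f) = pathClass I f.toPath * pathClass I p :=
  pathClass_comp p f.toPath

theorem pathClass_mem_corner {j k : V} (p : Quiver.Path j k) :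
    pathClass I p ∈ corner K (vertexIdem I) k j := by
  refine ⟨?_, ?_⟩
  · rw [vertexIdem, ← pathClass_comp, Quiver.Path.comp_nil]
  · rw [vertexIdem, ← pathClass_comp, Quiver.Path.nil_comp]

theorem isIdempotentElem_vertexIdem (i : V) : IsIdempotentElem (vertexIdem I i) :=
  (pathClass_mem_corner Quiver.Path.nil).1

theorem sum_vertexIdem : ∑ i, vertexIdem I i = 1 := by
  rw [← map_one I.ringCon.mk', one_def, map_sum]
  rfl

theorem corner_le_span_pathClass (k j : V) : corner K (vertexIdem I) k j ≤
    Submodule.span K (Set.range fun p : Quiver.Path j k => pathClass I p) := by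
  set S := Submodule.span K (Set.range fun p : Quiver.Path j k => pathClass I p)
  intro x hx
  have h := mem_of_pathClass_mem (I := I) (S := S.comap
    (LinearMap.mulLeft K (vertexIdem I k) ∘ₗ LinearMap.mulRight K (vertexIdem I j)))
    (fun a b p => by
      change vertexIdem I k * (pathClass I p * vertexIdem I j) ∈ S
      by_cases hj : j = a
      · subst hj
        by_cases hk : b = k
        · subst hk
          rw [(pathClass_mem_corner p).2, (pathClass_mem_corner p).1]
          exact Submodule.subset_span ⟨p, rfl⟩
        · rw [(pathClass_mem_corner p).2, vertexIdem, pathClass_mul_of_ne _ _ hk]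
          exact zero_mem _
      · rw [vertexIdem, vertexIdem, pathClass_mul_of_ne _ _ hj, mul_zero]
        exact zero_mem _) x
  change vertexIdem I k * (x * vertexIdem I j) ∈ S at h
  rwa [hx.2, hx.1] at h

theorem exists_path_mul_ne_zero {k j : V} {x y : BoundQuiverAlgebra I}
    (hx : x ∈ corner K (vertexIdem I) k j) (h : x * y ≠ 0) :
    ∃ p : Quiver.Path j k, pathClass I p * y ≠ 0 := by
  by_contra! hc
  have hle : corner K (vertexIdem I) k j ≤ LinearMap.ker (LinearMap.mulRight K y) :=
    (corner_le_span_pathClass k j).trans (Submodule.span_le.2 (by rintro _ ⟨p, rfl⟩; exact hc p))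
  exact h (hle hx)

theorem exists_path_mul_ne_zero' {k j : V} {x y : BoundQuiverAlgebra I}
    (hx : x ∈ corner K (vertexIdem I) k j) (h : y * x ≠ 0) :
    ∃ p : Quiver.Path j k, y * pathClass I p ≠ 0 := by
  by_contra! hc
  have hle : corner K (vertexIdem I) k j ≤ LinearMap.ker (LinearMap.mulLeft K y) :=
    (corner_le_span_pathClass k j).trans (Submodule.span_le.2 (by rintro _ ⟨p, rfl⟩; exact hc p))
  exact h (hle hx)

theorem finite_boundQuiverAlgebra [∀ i j : V, Finite (i ⟶ j)] (hI : IsAdmissible I) :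
    Module.Finite K (BoundQuiverAlgebra I) := by
  obtain ⟨⟨m, -, hm⟩, -⟩ := hI
  have hfin : {x : QPath V | x.2.2.length < m}.Finite := by
    have : {x : QPath V | x.2.2.length < m} = ⋃ l ∈ Set.Iio m, {x : QPath V | x.2.2.length = l} := by
      ext x
      simp
    rw [this]
    exact (Set.finite_Iio m).biUnion fun l _ => finite_setOf_length_eq l
  refine ⟨Submodule.fg_def.2 ⟨_, hfin.image fun x => pathClass I x.2.2,
    Submodule.eq_top_iff'.2 (mem_of_pathClass_mem fun j k p => ?_)⟩⟩
  rcases lt_or_ge p.length m with h | h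
  · exact Submodule.subset_span ⟨⟨j, k, p⟩, h, rfl⟩
  · have : pathClass I p = 0 :=
      quotientLinearMap_eq_zero_iff.2 (hm _ (Submodule.subset_span ⟨j, k, p, h, rfl⟩))
    rw [this]
    exact zero_mem _

/-- An arrow between different vertices does not factor through other vertices modulo `I`. -/
theorem pathClass_toPath_notMem_cornerTrace (hI : IsAdmissible I) {l m : V} (a : l ⟶ m)
    {s : Set V} (hs : ∀ t ∈ s, t ≠ l ∧ t ≠ m) :
    pathClass I a.toPath ∉ cornerTrace K (vertexIdem I) s m l := by
  intro h
  have hle : cornerTrace K (vertexIdem I) s m l ≤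
      (arrowIdealPow K (V := V) 2).map (quotientLinearMap I) := by
    refine iSup₂_le fun t ht => (mul_le_mul' (corner_le_span_pathClass m t)
      (corner_le_span_pathClass t l)).trans ?_
    rw [Submodule.span_mul_span, Submodule.span_le]
    rintro _ ⟨_, ⟨p, rfl⟩, _, ⟨q, rfl⟩, rfl⟩
    refine ⟨ofPath K (q.comp p), Submodule.subset_span ⟨_, _, _, ?_, rfl⟩, pathClass_comp q p⟩
    -- As t differs from both ends of the arrow, both factors have positive length and their product
    -- lies in R². Since I ⊆ R², the arrow itself would then lie in R².
    have hp : p.length ≠ 0 := fun h => (hs t ht).2 (p.eq_of_length_zero h)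
    have hq : q.length ≠ 0 := fun h => (hs t ht).1 (q.eq_of_length_zero h).symm
    rw [Quiver.Path.length_comp]
    omega
  obtain ⟨z, hz, hza⟩ := hle h
  have h1 : ofPath K a.toPath - z ∈ I := by
    rw [← quotientLinearMap_eq_zero_iff, map_sub, hza, sub_eq_zero]
    rfl
  have h2 := add_mem (hI.2 _ h1) hz
  rw [sub_add_cancel] at h2
  exact absurd (le_length_of_ofPath_mem_arrowIdealPow h2)
    (by rw [Quiver.Path.length_toPath]; decide)

end BoundQuiverLemmas

/-! ### Monotone paths and nonvanishing against v and w -/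

section IncreasingDecreasing

open PathAlgebra

variable {K : Type*} [Field K] {V : Type*} [Quiver V] [Fintype V] [PartialOrder V]
  {I : TwoSidedIdeal (PathAlgebra K V)} {n : V} {v w : V → BoundQuiverAlgebra I}

/-- Each initial segment sends v_i to a nonzero multiple of some v_b. If the next arrow b → c killed
v_b, it would factor through vertices s > b > c, none of which is an end of the arrow. -/
theorem IsStandardFamily.pathClass_mul_ne_zero (hv : IsStandardFamily K (vertexIdem I) n v)
    (hI : IsAdmissible I) {i k : V} {d : Quiver.Path i k} (hd : d.IsDecreasing) :
    pathClass I d * v i ≠ 0 := by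
  induction d with
  | nil =>
    change vertexIdem I i * v i ≠ 0
    rw [(hv.mem i).1]
    exact hv.ne_zero i
  | @cons b c p a ih =>
    obtain ⟨t, ht⟩ := hv.exists_smul b _ (mul_mem_corner (pathClass_mem_corner p) (hv.mem i))
    have ht0 : t ≠ 0 := fun h => ih hd.1 (by rw [← ht, h, zero_smul])
    rw [pathClass_cons, mul_assoc, ← ht, mul_smul_comm]
    refine smul_ne_zero ht0 fun h => pathClass_toPath_notMem_cornerTrace hI a (fun s hs => ?_)
      (hv.mem_of_mul_eq_zero c b _ (pathClass_mem_corner _) h)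
    exact ⟨ne_of_gt hs, ne_of_gt (hd.2.trans hs)⟩

theorem IsCostandardFamily.mul_pathClass_ne_zero (hw : IsCostandardFamily K (vertexIdem I) n w)
    (hI : IsAdmissible I) {j i : V} {u : Quiver.Path j i} (hu : u.IsIncreasing) :
    w i * pathClass I u ≠ 0 := by
  induction u with
  | nil =>
    change w j * vertexIdem I j ≠ 0
    rw [(hw.mem j).2]
    exact hw.ne_zero j
  | @cons b c p a ih =>
    obtain ⟨t, ht⟩ := hw.exists_smul b _
      (mul_mem_corner (hw.mem c) (pathClass_mem_corner a.toPath))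
    have ha : w c * pathClass I a.toPath ≠ 0 := fun h =>
      pathClass_toPath_notMem_cornerTrace hI a
        (fun s hs => ⟨ne_of_gt (hu.2.trans hs), ne_of_gt hs⟩)
        (hw.mem_of_mul_eq_zero c b _ (pathClass_mem_corner _) h)
    have ht0 : t ≠ 0 := fun h => ha (by rw [← ht, h, zero_smul])
    rw [pathClass_cons, ← mul_assoc, ← ht, smul_mul_assoc]
    exact smul_ne_zero ht0 (ih hu.1)

/-- An arrow b → c with c ≰ b kills v_b, so each arrow of q is a descent or a loop. Loops are
discarded. -/
theorem IsStandardFamily.exists_isDecreasing (hv : IsStandardFamily K (vertexIdem I) n v)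
    {i k : V} (q : Quiver.Path i k) (hq : pathClass I q * v i ≠ 0) :
    ∃ d : Quiver.Path i k, d.IsDecreasing := by
  induction q with
  | nil => exact ⟨Quiver.Path.nil, trivial⟩
  | @cons b c p a ih =>
    obtain ⟨t, ht⟩ := hv.exists_smul b _ (mul_mem_corner (pathClass_mem_corner p) (hv.mem i))
    rw [pathClass_cons, mul_assoc, ← ht, mul_smul_comm] at hq
    obtain ⟨d, hd⟩ := ih fun h => left_ne_zero_of_smul hq (by
      rwa [← ht, smul_eq_zero_iff_left (hv.ne_zero b)] at h)
    have hcb : c ≤ b := by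
      by_contra h
      exact right_ne_zero_of_smul hq
        (hv.mul_eq_zero isIdempotentElem_vertexIdem h (pathClass_mem_corner _))
    rcases hcb.eq_or_lt with rfl | h
    · exact ⟨d, hd⟩
    · exact ⟨d.cons a, hd, h⟩

theorem IsCostandardFamily.exists_isIncreasing (hw : IsCostandardFamily K (vertexIdem I) n w)
    {j i : V} (q : Quiver.Path j i) (hq : w i * pathClass I q ≠ 0) :
    ∃ u : Quiver.Path j i, u.IsIncreasing := by
  induction q with
  | nil => exact ⟨Quiver.Path.nil, trivial⟩
  | @cons b c p a ih =>
    obtain ⟨t, ht⟩ := hw.exists_smul b _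
      (mul_mem_corner (hw.mem c) (pathClass_mem_corner a.toPath))
    rw [pathClass_cons, ← mul_assoc] at hq
    have hbc : b ≤ c := by
      by_contra h
      refine left_ne_zero_of_mul hq ?_
      exact hw.mul_eq_zero isIdempotentElem_vertexIdem h (pathClass_mem_corner _)
    rw [← ht, smul_mul_assoc] at hq
    obtain ⟨u, hu⟩ := ih (right_ne_zero_of_smul hq)
    rcases hbc.eq_or_lt with rfl | h
    · exact ⟨u, hu⟩
    · exact ⟨u.cons a, hu, h⟩

end IncreasingDecreasing

/-! ### The bases and the generators of I -/

section Bases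

open PathAlgebra

variable {K : Type*} [Field K] {V : Type*} [Quiver V] [Fintype V] [PartialOrder V]
  {I : TwoSidedIdeal (PathAlgebra K V)}

theorem IsOneQuasiHereditary.nonempty_standardPaths [Module.Finite K (BoundQuiverAlgebra I)]
    (hA : IsOneQuasiHereditary K (vertexIdem I)) : Nonempty (StandardPaths V) := by
  obtain ⟨n, hn⟩ := hA.exists_top
  obtain ⟨v, hv⟩ := hA.exists_isStandardFamily isIdempotentElem_vertexIdem hn
  obtain ⟨w, hw⟩ := hA.exists_isCostandardFamily isIdempotentElem_vertexIdem hn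
  have hd : ∀ i k : V, k ≤ i → ∃ d : Quiver.Path i k, d.IsDecreasing := fun i k h => by
    obtain ⟨x, hx, hx0⟩ := hv.exists_mul_ne_zero k i h
    obtain ⟨q, hq⟩ := exists_path_mul_ne_zero hx hx0
    exact hv.exists_isDecreasing q hq
  have hu : ∀ j i : V, j ≤ i → ∃ u : Quiver.Path j i, u.IsIncreasing := fun j i h => by
    obtain ⟨x, hx, hx0⟩ := hA.exists_mul_ne_zero isIdempotentElem_vertexIdem hv hw h
    obtain ⟨q, hq⟩ := exists_path_mul_ne_zero' hx hx0
    exact hw.exists_isIncreasing q hq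
  choose d hd using hd
  choose u hu using hu
  exact ⟨⟨fun j i k hj hk => (u j i hj).comp (d i k hk), fun j i k hj hk =>
    ⟨_, _, hu j i hj, hd i k hk, rfl⟩⟩⟩

theorem IsOneQuasiHereditary.span_standardPaths [Module.Finite K (BoundQuiverAlgebra I)]
    (hA : IsOneQuasiHereditary K (vertexIdem I)) (hI : IsAdmissible I) (p : StandardPaths V)
    (j k : V) : Submodule.span K (Set.range fun i : {i : V // j ≤ i ∧ k ≤ i} =>
      pathClass I (p.path j i k i.2.1 i.2.2)) = corner K (vertexIdem I) k j := by
  refine le_antisymm (Submodule.span_le.2 ?_) ?_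
  · rintro _ ⟨i, rfl⟩
    exact pathClass_mem_corner _
  obtain ⟨n, hn⟩ := hA.exists_top
  have he := isIdempotentElem_vertexIdem (I := I)
  obtain ⟨v, hv⟩ := hA.exists_isStandardFamily he hn
  obtain ⟨w, hw⟩ := hA.exists_isCostandardFamily he hn
  -- The spanning lemma needs d_i for all i ≥ k and u_i for all i ≥ j, even when only one inequality
  -- holds. There any element that is not killed serves, the other factor being 0.
  have hdu : ∀ i : V, ∃ d ∈ corner K (vertexIdem I) k i, ∃ u ∈ corner K (vertexIdem I) i j,
      (¬ k ≤ i → d = 0) ∧ (¬ j ≤ i → u = 0) ∧ (k ≤ i → d * v i ≠ 0) ∧ (j ≤ i → w i * u ≠ 0) ∧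
      ∀ (hj : j ≤ i) (hk : k ≤ i), d * u = pathClass I (p.path j i k hj hk) := by
    intro i
    by_cases hk : k ≤ i <;> by_cases hj : j ≤ i
    · obtain ⟨u, d, hu, hd, hp⟩ := p.exists_eq_comp j i k hj hk
      exact ⟨_, pathClass_mem_corner d, _, pathClass_mem_corner u, absurd hk, absurd hj,
        fun _ => hv.pathClass_mul_ne_zero hI hd, fun _ => hw.mul_pathClass_ne_zero hI hu,
        fun _ _ => by rw [hp, pathClass_comp]⟩
    · obtain ⟨d, hd, hd0⟩ := hv.exists_mul_ne_zero k i hk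
      exact ⟨d, hd, 0, zero_mem _, absurd hk, fun _ => rfl, fun _ => hd0,
        fun h => absurd h hj, fun h => absurd h hj⟩
    · obtain ⟨u, hu, hu0⟩ := hA.exists_mul_ne_zero he hv hw hj
      exact ⟨0, zero_mem _, u, hu, fun _ => rfl, absurd hj, fun h => absurd h hk, fun _ => hu0,
        fun _ h => absurd h hk⟩
    · exact ⟨0, zero_mem _, 0, zero_mem _, fun _ => rfl, fun _ => rfl, fun h => absurd h hk,
        fun h => absurd h hj, fun h => absurd h hj⟩
  choose d hd u hu hd0 hu0 hdv hwu hp using hdu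
  have h := corner_le_span_mul_of_families he hv hw hd hu hd0 hu0 hdv
    (fun i hi h => absurd h (hwu i hi))
  rwa [show (fun i : {i : V // j ≤ i ∧ k ≤ i} => d i.1 * u i.1) =
    fun i : {i : V // j ≤ i ∧ k ≤ i} => pathClass I (p.path j i k i.2.1 i.2.2) from
      funext fun i => hp i.1 i.2.1 i.2.2] at h

theorem IsOneQuasiHereditary.linearIndependent_standardPaths
    [Module.Finite K (BoundQuiverAlgebra I)]
    (hA : IsOneQuasiHereditary K (vertexIdem I)) (hI : IsAdmissible I) (p : StandardPaths V) :
    LinearIndependent K fun x : {x : V × V × V // x.1 ≤ x.2.1 ∧ x.2.2 ≤ x.2.1} =>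
      pathClass I (p.path x.1.1 x.1.2.1 x.1.2.2 x.2.1 x.2.2) := by
  classical
  rw [Fintype.linearIndependent_iff]
  rintro g hg ⟨⟨j, i, k⟩, hj, hk⟩
  have hli := hA.linearIndependent_of_corner_eq_span isIdempotentElem_vertexIdem
    (hA.span_standardPaths hI p j k)
  rw [Fintype.linearIndependent_iff] at hli
  refine hli (fun i => g ⟨⟨j, i, k⟩, i.2⟩) ?_ ⟨i, hj, hk⟩
  -- Multiplying by e_k and e_j retains only the paths from j to k, reducing to independence in one
  -- corner.
  have h1 := congrArg (fun z => vertexIdem I k * z * vertexIdem I j) hg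
  rw [mul_zero, zero_mul, Finset.mul_sum, Finset.sum_mul] at h1
  rw [← h1]
  refine Finset.sum_of_injOn (fun i : {i : V // j ≤ i ∧ k ≤ i} =>
    (⟨⟨j, i, k⟩, i.2⟩ : {x : V × V × V // x.1 ≤ x.2.1 ∧ x.2.2 ≤ x.2.1})) ?_ ?_ ?_ ?_
  · intro a _ b _ hab
    exact Subtype.ext (congrArg (fun z => z.1.2.1) hab)
  · exact fun _ _ => Finset.mem_coe.2 (Finset.mem_univ _)
  · rintro ⟨⟨a, b, c⟩, ha, hc⟩ _ hx
    rw [mul_smul_comm, smul_mul_assoc]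
    by_cases hck : c = k
    · by_cases haj : j = a
      · subst hck haj
        exact absurd ⟨⟨b, ha, hc⟩, Finset.mem_coe.2 (Finset.mem_univ _), rfl⟩ hx
      · rw [mul_assoc, vertexIdem, vertexIdem, pathClass_mul_of_ne _ _ haj, mul_zero, smul_zero]
    · rw [vertexIdem, pathClass_mul_of_ne _ _ hck, zero_mul, smul_zero]
  · intro i _
    have := pathClass_mem_corner (I := I) (p.path j i k i.2.1 i.2.2)
    rw [mul_smul_comm, smul_mul_assoc, this.1, this.2]

theorem IsOneQuasiHereditary.span_standardPaths_eq_projModule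
    [Module.Finite K (BoundQuiverAlgebra I)]
    (hA : IsOneQuasiHereditary K (vertexIdem I)) (hI : IsAdmissible I) (p : StandardPaths V)
    (j : V) : Submodule.span K (Set.range fun x : {x : V × V // j ≤ x.1 ∧ x.2 ≤ x.1} =>
      pathClass I (p.path j x.1.1 x.1.2 x.2.1 x.2.2)) =
        (projModule (vertexIdem I) j).restrictScalars K := by
  refine le_antisymm (Submodule.span_le.2 ?_) fun x hx => ?_
  · rintro _ ⟨x, rfl⟩
    exact (pathInProj I (p.path j x.1.1 x.1.2 x.2.1 x.2.2)).2
  · have hx' := (mem_projModule_iff (isIdempotentElem_vertexIdem j)).1 hx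
    rw [← one_mul x, ← sum_vertexIdem, Finset.sum_mul]
    refine sum_mem fun k _ => ?_
    have hk : vertexIdem I k * x ∈ corner K (vertexIdem I) k j := by
      have := idem_mul_mul_idem_mem_corner (K := K) (isIdempotentElem_vertexIdem (I := I)) k j x
      rwa [mul_assoc, hx'] at this
    rw [← hA.span_standardPaths hI p j k] at hk
    refine Submodule.span_mono ?_ hk
    rintro _ ⟨i, rfl⟩
    exact ⟨⟨⟨i, k⟩, i.2⟩, rfl⟩

theorem IsOneQuasiHereditary.span_standardPaths_eq_top [Module.Finite K (BoundQuiverAlgebra I)]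
    (hA : IsOneQuasiHereditary K (vertexIdem I)) (hI : IsAdmissible I) (p : StandardPaths V) :
    Submodule.span K (Set.range fun x : {x : V × V × V // x.1 ≤ x.2.1 ∧ x.2.2 ≤ x.2.1} =>
      pathClass I (p.path x.1.1 x.1.2.1 x.1.2.2 x.2.1 x.2.2)) = ⊤ := by
  refine Submodule.eq_top_iff'.2 fun x => ?_
  rw [← mul_one x, ← sum_vertexIdem, Finset.mul_sum]
  refine sum_mem fun j _ => ?_
  have hj : x * vertexIdem I j ∈ (projModule (vertexIdem I) j).restrictScalars K :=
    Submodule.mem_span_singleton.2 ⟨x, rfl⟩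
  rw [← hA.span_standardPaths_eq_projModule hI p j] at hj
  refine Submodule.span_mono ?_ hj
  rintro _ ⟨y, rfl⟩
  exact ⟨⟨⟨j, y.1.1, y.1.2⟩, y.2⟩, rfl⟩

/-- A two-sided ideal of the path algebra as a subspace. -/
def idealSubmodule (J : TwoSidedIdeal (PathAlgebra K V)) : Submodule K (PathAlgebra K V) where
  carrier := {z | z ∈ J}
  zero_mem' := J.zero_mem
  add_mem' := J.add_mem
  smul_mem' c z hz := by
    rw [← one_mul z, ← smul_mul_assoc]
    exact J.mul_mem_left _ _ hz

theorem StandardPaths.sup_span_eq_top (p : StandardPaths V)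
    (c : ∀ j k : V, Quiver.Path j k → {i : V // j ≤ i ∧ k ≤ i} → K) :
    idealSubmodule (TwoSidedIdeal.span
        {x | ∃ (j k : V) (q : Quiver.Path j k), x = p.relation q (c j k q)}) ⊔
      Submodule.span K (Set.range fun x : {x : V × V × V // x.1 ≤ x.2.1 ∧ x.2.2 ≤ x.2.1} =>
        ofPath K (p.path x.1.1 x.1.2.1 x.1.2.2 x.2.1 x.2.2)) = ⊤ := by
  classical
  refine Submodule.eq_top_iff'.2 (mem_of_ofPath_mem fun j k q => ?_)
  rw [← sub_add_cancel (ofPath K q) (∑ i, c j k q i • ofPath K (p.path j i k i.2.1 i.2.2))]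
  refine Submodule.add_mem_sup (TwoSidedIdeal.subset_span ⟨j, k, q, ?_⟩) ?_
  · rw [StandardPaths.relation]
  · exact sum_mem fun i _ => Submodule.smul_mem _ _
      (Submodule.subset_span ⟨⟨⟨j, i, k⟩, i.2⟩, rfl⟩)

theorem IsOneQuasiHereditary.exists_eq_span_relation [Module.Finite K (BoundQuiverAlgebra I)]
    (hA : IsOneQuasiHereditary K (vertexIdem I)) (hI : IsAdmissible I) (p : StandardPaths V) :
    ∃ c : ∀ j k : V, Quiver.Path j k → {i : V // j ≤ i ∧ k ≤ i} → K,
      I = TwoSidedIdeal.span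
        {x | ∃ (j k : V) (q : Quiver.Path j k), x = p.relation q (c j k q)} := by
  classical
  have hc : ∀ (j k : V) (q : Quiver.Path j k), ∃ c : {i : V // j ≤ i ∧ k ≤ i} → K,
      p.relation q c ∈ I := by
    intro j k q
    have hq := pathClass_mem_corner (I := I) q
    rw [← hA.span_standardPaths hI p j k, Submodule.mem_span_range_iff_exists_fun] at hq
    obtain ⟨c, hc⟩ := hq
    refine ⟨c, quotientLinearMap_eq_zero_iff.1 ?_⟩
    rw [StandardPaths.relation, map_sub, map_sum, sub_eq_zero]
    refine hc.symm.trans ?_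
    exact Finset.sum_congr rfl fun i _ => (map_smul (quotientLinearMap I) _ _).symm
  choose c hc using hc
  refine ⟨c, le_antisymm (fun z hz => ?_) (TwoSidedIdeal.span_le.2 ?_)⟩
  · have hJI : TwoSidedIdeal.span
        {x | ∃ (j k : V) (q : Quiver.Path j k), x = p.relation q (c j k q)} ≤ I := by
      refine TwoSidedIdeal.span_le.2 ?_
      rintro _ ⟨j, k, q, rfl⟩
      exact hc j k q
    -- Split z in I as a + b with a in the ideal of relations and b a combination of standard paths.
    -- Then b lies in I, so independence modulo I makes its coefficients vanish.
    obtain ⟨a, ha, b, hb, rfl⟩ := Submodule.mem_sup.1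
      ((p.sup_span_eq_top c).ge (Submodule.mem_top (x := z)))
    have hbI : b ∈ I := by
      have := I.sub_mem hz (hJI ha)
      rwa [add_sub_cancel_left] at this
    obtain ⟨g, rfl⟩ := (Submodule.mem_span_range_iff_exists_fun K).1 hb
    rw [← quotientLinearMap_eq_zero_iff, map_sum] at hbI
    have hg := Fintype.linearIndependent_iff.1 (hA.linearIndependent_standardPaths hI p) g
      (by rw [← hbI]; exact Finset.sum_congr rfl fun x _ => (map_smul (quotientLinearMap I) _ _).symm)
    rw [Finset.sum_eq_zero fun x _ => by rw [hg x, zero_smul], add_zero]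
    exact ha
  · rintro _ ⟨j, k, q, rfl⟩
    exact hc j k q

end Bases

theorem mainTheorem2 {K : Type*} [Field K] [IsAlgClosed K]
    {V : Type*} [Quiver V] [PartialOrder V] [Fintype V] [∀ i j : V, Finite (i ⟶ j)]
    (I : TwoSidedIdeal (PathAlgebra K V)) (hI : PathAlgebra.IsAdmissible I)
    (hA : IsOneQuasiHereditary K (vertexIdem I)) :
    Nonempty (StandardPaths V) ∧
    ∀ p : StandardPaths V,
      (∀ j k : V, ∃ b : Module.Basis {i : V // j ≤ i ∧ k ≤ i} K
          (vertexSpace K (vertexIdem I) (projModule (vertexIdem I) j) k),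
        ∀ i, b i = pathInVertexSpace I (p.path j i k i.2.1 i.2.2)) ∧
      (∀ j : V, ∃ b : Module.Basis {x : V × V // j ≤ x.1 ∧ x.2 ≤ x.1} K
          (projModule (vertexIdem I) j),
        ∀ x, b x = pathInProj I (p.path j x.1.1 x.1.2 x.2.1 x.2.2)) ∧
      (∃ b : Module.Basis {x : V × V × V // x.1 ≤ x.2.1 ∧ x.2.2 ≤ x.2.1} K
          (BoundQuiverAlgebra I),
        ∀ x, b x = pathClass I (p.path x.1.1 x.1.2.1 x.1.2.2 x.2.1 x.2.2)) ∧
      (∃ c : ∀ j k : V, Quiver.Path j k → {i : V // j ≤ i ∧ k ≤ i} → K,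
        I = TwoSidedIdeal.span
          {x | ∃ (j k : V) (q : Quiver.Path j k), x = p.relation q (c j k q)}) := by
  have := finite_boundQuiverAlgebra hI
  have he := isIdempotentElem_vertexIdem (I := I)
  refine ⟨hA.nonempty_standardPaths, fun p => ⟨fun j k => ?_, fun j => ?_, ?_,
    hA.exists_eq_span_relation hI p⟩⟩
  · have hspan := hA.span_standardPaths hI p j k
    have hli := hA.linearIndependent_of_corner_eq_span he hspan
    refine ⟨(Module.Basis.span hli).map
      ((LinearEquiv.ofEq _ _ hspan).trans (vertexSpaceEquivCorner he k j).symm), fun i => ?_⟩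
    refine Subtype.ext (Subtype.ext ?_)
    exact (congrArg Subtype.val (Module.Basis.span_apply hli i) :)
  · have hli : LinearIndependent K fun x : {x : V × V // j ≤ x.1 ∧ x.2 ≤ x.1} =>
        pathClass I (p.path j x.1.1 x.1.2 x.2.1 x.2.2) :=
      (hA.linearIndependent_standardPaths hI p).comp
        (fun x : {x : V × V // j ≤ x.1 ∧ x.2 ≤ x.1} => ⟨⟨j, x.1.1, x.1.2⟩, x.2⟩)
        fun x y h => Subtype.ext (congrArg (fun z => z.1.2) h)
    let f : (projModule (vertexIdem I) j).restrictScalars K ≃ₗ[K] projModule (vertexIdem I) j :=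
      { toFun := fun x => ⟨x.1, x.2⟩
        invFun := fun x => ⟨x.1, x.2⟩
        map_add' := fun _ _ => rfl
        map_smul' := fun _ _ => rfl }
    refine ⟨(Module.Basis.span hli).map ((LinearEquiv.ofEq _ _
      (hA.span_standardPaths_eq_projModule hI p j)).trans f), fun x => Subtype.ext ?_⟩
    exact (congrArg Subtype.val (Module.Basis.span_apply hli x) :)
  · exact ⟨Module.Basis.mk (hA.linearIndependent_standardPaths hI p)
      (hA.span_standardPaths_eq_top hI p).ge, Module.Basis.mk_apply _ _⟩

end
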